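/- Let $\Lambda$ be a finite set, $\Lambda_0\subseteq\Lambda$, $\Lambda_0^c=\Lambda\setminus\Lambda_0$, and let $h$ be a real positive definite $\Lambda\times\Lambda$ matrix with $h=V\,\mathrm{diag}(\gamma_k^2)\,V^T$, where $V$ is orthogonal with columns $v_k$ ($k\in\Lambda$) and $\gamma_k>0$. For $\gamma>0$ and $n\in\mathbb N_0$ let $\psi_n^{(\gamma)}(y)=\frac{1}{\sqrt{2^n n!}}\left(\frac{\gamma}{\pi}\right)^{1/4}e^{-\frac12\gamma y^2}H_n(\gamma^{1/2}y)$, with $H_n$ the physicists' Hermite polynomial. For $\alpha\in\mathbb N_0^{\Lambda}$ let $\hat\Psi_\alpha(x)=\prod_{k\in\Lambda}\psi_{\alpha_k}^{(\gamma_k)}\big((V^Tx)_k\big)$, the eigenfunction with occupation numbers $\alpha$ of the oscillator Hamiltonian $p^Tp+x^Thx$ on $L^2(\mathbb R^\Lambda)$, and let $\varrho_\alpha$ be the rank one projection onto $\hat\Psi_\alpha$, with kernel $\varrho_\alpha(x,y)=\hat\Psi_\alpha(x)\hat\Psi_\alpha(y)$. Its reduced state $(\varrho_\alpha)_{\Lambda_0}$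 is the integral operator on $L^2(\mathbb R^{\Lambda_0})$ with kernel $$(\varrho_\alpha)_{\Lambda_0}(x,y)=\int_{\mathbb R^{\Lambda_0^c}}\varrho_\alpha\big((x,u),(y,u)\big)\,du .$$ Write $\varrho_0$ for $\alpha=0$ and $\varrho_{\mathfrak e_k}$ for $\alpha=\mathfrak e_k$ (a single excitation of mode $k$). Decompose $h^{1/2}=\begin{pmatrix}A&C\\ C^T&B\end{pmatrix}$ with respect to $\Lambda_0\cup\Lambda_0^c$ and put $\Theta=A^{-1/2}CB^{-1}C^TA^{-1/2}$, $F_1=A^{-1/2}(1-\tfrac12\Theta)^{-1/2}$. Let $F_2$ be orthogonal and $\sigma=(\sigma_j)_{j\in\Lambda_0}$ real with $-\tfrac12F_1^TCB^{-1}C^TF_1=F_2\,\mathrm{diag}(\sigma_j)\,F_2^T$, and let $F=F_1F_2$, $\mu_j=\left(\frac{1-\sigma_j}{1+\sigma_j}\right)^{1/2}$, $\kappa_j=\frac{2\mu_j}{1+\mu_j^2}$. Let $(\mathscr Of)(x)=|\det F|^{1/2}f(Fx)$, with adjoint $(\mathscr O^*f)(x)=|\det F|^{-1/2}f(F^{-1}x)$.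 For $n\in\mathbb N_0^{\Lambda_0}$ let $\Psi_n^{(\kappa)}(x)=\prod_{j\in\Lambda_0}\psi_{n_j}^{(\kappa_j)}(x_j)$, and $$\Big\langle\widehat{(\varrho_\alpha)}_{\Lambda_0}\Big\rangle_n=\Big\langle\Psi_n^{(\kappa)},\ \mathscr O(\varrho_\alpha)_{\Lambda_0}\mathscr O^*\,\Psi_n^{(\kappa)}\Big\rangle_{L^2(\mathbb R^{\Lambda_0})}.$$ Finally let $\nu_k=(v_k)_{\Lambda_0}-CB^{-1}(v_k)_{\Lambda_0^c}$ and $$Q_{k,j}=\gamma_k\left(\mu_j^2\,\big|\langle\delta_j,F_2^TA^{-1/2}\nu_k\rangle\big|^2+\big|\langle\delta_j,F_2^TA^{-1/2}(v_k)_{\Lambda_0}\rangle\big|^2\right),\qquad k\in\Lambda,\ j\in\Lambda_0 .$$ Then the following hold. 1. $-1<\sigma_j\le 0$ and $\mu_j\ge 1$ for all $j$, and $(1-\Theta)^{-1/2}=F_2\,\mathrm{diag}(\mu_j)\,F_2^T$; $F$ is invertible, and for $\alpha=0$ and $\alpha=\mathfrak e_k$ the integrals that define the reduced kernel and the diagonal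 entries converge absolutely. 2. $\displaystyle\Big\langle\widehat{(\varrho_0)}_{\Lambda_0}\Big\rangle_n=\prod_{j\in\Lambda_0}\frac{2}{1+\mu_j}\left(\frac{\mu_j-1}{\mu_j+1}\right)^{n_j}$ for all $n$. 3. For all $k\in\Lambda$ and all $n$ such that $\mu_j>1$ for every $j$ with $n_j\neq0$ (hence for all $n$ if all $\mu_j>1$), $$\Big\langle\widehat{(\varrho_{\mathfrak e_k})}_{\Lambda_0}\Big\rangle_n=\Big\langle\widehat{(\varrho_0)}_{\Lambda_0}\Big\rangle_n\left(1-\sum_{j\in\Lambda_0}\frac{\mu_j}{\mu_j+1}Q_{k,j}+\sum_{j\in\Lambda_0}\frac{2\mu_j}{\mu_j^2-1}Q_{k,j}\,n_j\right),$$ where the terms of the last sum with $n_j=0$ are read as $0$. 4. For all $k\in\Lambda$ and all $n$, whether or not some $\mu_j=1$, $$\Big\langle\widehat{(\varrho_{\mathfrak e_k})}_{\Lambda_0}\Big\rangle_n=\Big\langle\widehat{(\varrho_0)}_{\Lambda_0}\Big\rangle_n\left(1-\sum_{j\in\Lambda_0}\frac{\mu_j}{\mu_j+1}Q_{k,j}\right)+\sum_{j\in\Lambda_0,\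 n_j\ge1}\frac{2\mu_j}{(\mu_j+1)^2}\,Q_{k,j}\,n_j\,\Big\langle\widehat{(\varrho_0)}_{\Lambda_0}\Big\rangle_{n-\delta_j}.$$ 5. $\sum_{j\in\Lambda_0}Q_{k,j}\le 2$ for every $k\in\Lambda$, and $\sum_{k\in\Lambda}Q_{k,j}=2$ for every $j\in\Lambda_0$. -/

import Mathlib

open MeasureTheory Matrix

noncomputable section

namespace CoupledOscillators

/-! ### Hermite-Gaussian functions -/

/-- The physicists' Hermite polynomial, as a function:
`H_n(y) = (-1)^n e^{y²} (d/dy)^n e^{-y²}`. -/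
def hermiteH (n : ℕ) (y : ℝ) : ℝ :=
  (-1) ^ n * Real.exp (y ^ 2) * iteratedDeriv n (fun t : ℝ => Real.exp (-t ^ 2)) y

/-- The Hermite-Gaussian function `ψ_n^{(γ)}` on the line. -/
def hermiteGauss (γ : ℝ) (n : ℕ) (y : ℝ) : ℝ :=
  1 / Real.sqrt (2 ^ n * (n.factorial : ℝ)) * (γ / Real.pi) ^ (1 / 4 : ℝ)
    * Real.exp (-(1 / 2) * γ * y ^ 2) * hermiteH n (Real.sqrt γ * y)

/-- The product function `Ψ_n^{(γ)}(x) = ∏_j ψ_{n_j}^{(γ_j)}(x_j)`. -/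
def hermiteProd {ι : Type*} [Fintype ι] (γ : ι → ℝ) (n : ι → ℕ) (x : ι → ℝ) : ℝ :=
  ∏ j, hermiteGauss (γ j) (n j) (x j)

/-! ### Eigenstates of the oscillator Hamiltonian and their reduced states -/

/-- The real power `M ^ p` of a real symmetric matrix, by functional calculus. -/
def matPow {ι : Type*} [Fintype ι] [DecidableEq ι] (M : Matrix ι ι ℝ) (p : ℝ) : Matrix ι ι ℝ :=
  cfc (fun t : ℝ => t ^ p) M

section

variable {Λ : Type*} [Fintype Λ] [DecidableEq Λ]

/-- The eigenfunction `x ↦ Ψ_α^{(γ)}(Vᵀ x)` of `p^T p + x^T h x`, where `h = V diag(γ²) Vᵀ`. -/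
def eigenfunction (V : Matrix Λ Λ ℝ) (γ : Λ → ℝ) (α : Λ → ℕ) (x : Λ → ℝ) : ℝ :=
  hermiteProd γ α (Vᵀ *ᵥ x)

/-- The integral kernel of the rank one projection onto the (real) eigenfunction with
occupation numbers `α`. -/
def stateKernel (V : Matrix Λ Λ ℝ) (γ : Λ → ℝ) (α : Λ → ℕ) (x y : Λ → ℝ) : ℝ :=
  eigenfunction V γ α x * eigenfunction V γ α y

/-- The vector `(x, u)` of `ℝ^Λ` with components `x ∈ ℝ^{Λ₀}` and `u ∈ ℝ^{Λ∖Λ₀}`. -/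
def glue (Λ₀ : Finset Λ) (x : {i // i ∈ Λ₀} → ℝ) (u : {i // i ∉ Λ₀} → ℝ) : Λ → ℝ :=
  fun i => if hi : i ∈ Λ₀ then x ⟨i, hi⟩ else u ⟨i, hi⟩

/-- The kernel of the reduced state: the variables outside `Λ₀` are traced out. -/
def reducedKernel (Λ₀ : Finset Λ) (K : (Λ → ℝ) → (Λ → ℝ) → ℝ)
    (x y : {i // i ∈ Λ₀} → ℝ) : ℝ :=
  ∫ u : {i // i ∉ Λ₀} → ℝ, K (glue Λ₀ x u) (glue Λ₀ y u)

end

/-! ### Integral operators and the change of variables -/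

section

variable {ι : Type*} [Fintype ι] [DecidableEq ι]

/-- The integral operator with kernel `K`. -/
def integralOp (K : (ι → ℝ) → (ι → ℝ) → ℝ) (f : (ι → ℝ) → ℝ) (x : ι → ℝ) : ℝ :=
  ∫ y, K x y * f y

/-- The unitary `(𝒪 f)(x) = |det F|^{1/2} f(F x)`. -/
def changeVar (F : Matrix ι ι ℝ) (f : (ι → ℝ) → ℝ) (x : ι → ℝ) : ℝ :=
  |F.det| ^ (1 / 2 : ℝ) * f (F *ᵥ x)

/-- Its adjoint `(𝒪* f)(x) = |det F|^{-1/2} f(F⁻¹ x)`. -/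
def changeVarAdj (F : Matrix ι ι ℝ) (f : (ι → ℝ) → ℝ) (x : ι → ℝ) : ℝ :=
  |F.det| ^ (-(1 / 2) : ℝ) * f (F⁻¹ *ᵥ x)

/-- The diagonal entry `⟨φ, 𝒪 K 𝒪* φ⟩` in `L²(ℝ^ι)` of the transformed integral operator with
kernel `K`, for a real function `φ`. -/
def transformedEntry (F : Matrix ι ι ℝ) (K : (ι → ℝ) → (ι → ℝ) → ℝ) (φ : (ι → ℝ) → ℝ) : ℝ :=
  ∫ x, φ x * changeVar F (integralOp K (changeVarAdj F φ)) x

/-- `μ_j = ((1 - σ_j) / (1 + σ_j))^{1/2}`. -/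
def mu (σ : ι → ℝ) (j : ι) : ℝ := Real.sqrt ((1 - σ j) / (1 + σ j))

/-- `κ_j = 2 μ_j / (1 + μ_j²)`. -/
def kappa (σ : ι → ℝ) (j : ι) : ℝ := 2 * mu σ j / (1 + mu σ j ^ 2)

end

/-! ### Blocks of `h^{1/2}` and the matrices built from them -/

section

variable {Λ : Type*} [Fintype Λ] [DecidableEq Λ]

/-- The `Λ₀ × Λ₀` block `A` of `h^{1/2} = [[A, C], [Cᵀ, B]]`. -/
def blockA (Λ₀ : Finset Λ) (h : Matrix Λ Λ ℝ) : Matrix {i // i ∈ Λ₀} {i // i ∈ Λ₀} ℝ :=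
  (matPow h (1 / 2)).submatrix Subtype.val Subtype.val

/-- The `Λ₀ × (Λ∖Λ₀)` block `C` of `h^{1/2}`. -/
def blockC (Λ₀ : Finset Λ) (h : Matrix Λ Λ ℝ) : Matrix {i // i ∈ Λ₀} {i // i ∉ Λ₀} ℝ :=
  (matPow h (1 / 2)).submatrix Subtype.val Subtype.val

/-- The `(Λ∖Λ₀) × (Λ∖Λ₀)` block `B` of `h^{1/2}`. -/
def blockB (Λ₀ : Finset Λ) (h : Matrix Λ Λ ℝ) : Matrix {i // i ∉ Λ₀} {i // i ∉ Λ₀} ℝ :=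
  (matPow h (1 / 2)).submatrix Subtype.val Subtype.val

/-- `C B⁻¹ Cᵀ`. -/
def blockCBC (Λ₀ : Finset Λ) (h : Matrix Λ Λ ℝ) : Matrix {i // i ∈ Λ₀} {i // i ∈ Λ₀} ℝ :=
  blockC Λ₀ h * (blockB Λ₀ h)⁻¹ * (blockC Λ₀ h)ᵀ

/-- `Θ = A^{-1/2} C B⁻¹ Cᵀ A^{-1/2}`. -/
def matTheta (Λ₀ : Finset Λ) (h : Matrix Λ Λ ℝ) : Matrix {i // i ∈ Λ₀} {i // i ∈ Λ₀} ℝ :=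
  matPow (blockA Λ₀ h) (-(1 / 2)) * blockCBC Λ₀ h * matPow (blockA Λ₀ h) (-(1 / 2))

/-- `F₁ = A^{-1/2} (1 - Θ/2)^{-1/2}`. -/
def matF1 (Λ₀ : Finset Λ) (h : Matrix Λ Λ ℝ) : Matrix {i // i ∈ Λ₀} {i // i ∈ Λ₀} ℝ :=
  matPow (blockA Λ₀ h) (-(1 / 2)) * matPow (1 - (1 / 2 : ℝ) • matTheta Λ₀ h) (-(1 / 2))

/-- The restriction to `Λ₀` of the eigenvector `v_k`, the `k`-th column of `V`. -/
def eigvecIn (Λ₀ : Finset Λ) (V : Matrix Λ Λ ℝ) (k : Λ) : {i // i ∈ Λ₀} → ℝ :=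
  fun i => V i.1 k

/-- The restriction to `Λ∖Λ₀` of the eigenvector `v_k`. -/
def eigvecOut (Λ₀ : Finset Λ) (V : Matrix Λ Λ ℝ) (k : Λ) : {i // i ∉ Λ₀} → ℝ :=
  fun i => V i.1 k

/-- `ν_k = (v_k)_{Λ₀} - C B⁻¹ (v_k)_{Λ∖Λ₀}`. -/
def nuVec (Λ₀ : Finset Λ) (h V : Matrix Λ Λ ℝ) (k : Λ) : {i // i ∈ Λ₀} → ℝ :=
  eigvecIn Λ₀ V k - (blockC Λ₀ h * (blockB Λ₀ h)⁻¹) *ᵥ eigvecOut Λ₀ V k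

/-- `Q_{k,j} = γ_k (μ_j² |⟨δ_j, F₂ᵀ A^{-1/2} ν_k⟩|² + |⟨δ_j, F₂ᵀ A^{-1/2} (v_k)_{Λ₀}⟩|²)`. -/
def weightQ (Λ₀ : Finset Λ) (h V : Matrix Λ Λ ℝ) (γ : Λ → ℝ)
    (F₂ : Matrix {i // i ∈ Λ₀} {i // i ∈ Λ₀} ℝ) (σ : {i // i ∈ Λ₀} → ℝ)
    (k : Λ) (j : {i // i ∈ Λ₀}) : ℝ :=
  γ k * (mu σ j ^ 2 * |((F₂ᵀ * matPow (blockA Λ₀ h) (-(1 / 2))) *ᵥ nuVec Λ₀ h V k) j| ^ 2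
    + |((F₂ᵀ * matPow (blockA Λ₀ h) (-(1 / 2))) *ᵥ eigvecIn Λ₀ V k) j| ^ 2)

/-- The diagonal entry of the transformed reduced state with occupation numbers `α`, in the basis
vector `Ψ_n^{(κ)}`, where the change of variables is given by `F = F₁ F₂`. -/
def diagEntry (Λ₀ : Finset Λ) (h V : Matrix Λ Λ ℝ) (γ : Λ → ℝ)
    (F₂ : Matrix {i // i ∈ Λ₀} {i // i ∈ Λ₀} ℝ) (σ : {i // i ∈ Λ₀} → ℝ)
    (α : Λ → ℕ) (n : {i // i ∈ Λ₀} → ℕ) : ℝ :=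
  transformedEntry (matF1 Λ₀ h * F₂) (reducedKernel Λ₀ (stateKernel V γ α))
    (hermiteProd (kappa σ) n)

end

end CoupledOscillators

end

/-!
Write `h^{1/2} = V diag(γ) Vᵀ` in blocks `A`, `B`, `C`, let `T = A - C B⁻¹ Cᵀ` be the Schur
complement, and let `a_k`, `o_k` be the parts of `v_k` inside and outside `Λ₀`. The ground state is
the Gaussian `exp(-xᵀ h^{1/2} x / 2)`, up to normalization, and exciting the mode `k` multiplies it
by `√(2γ_k) ⟨v_k, x⟩`. Tracing out the variables outside `Λ₀` is therefore a Gaussian integral with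
quadratic form `B`: completing the square (`integral_gaussian_quadratic_linear`) gives the reduced
ground state as a Gaussian kernel (`reducedKernel_zero`), and the reduced excited state as this
kernel times
`2γ_k (⟨ν_k, x+y⟩²/4 - ⟨a_k, x-y⟩²/4 + ⟨o_k, B⁻¹ o_k⟩/2)` (`reducedKernel_single`).

The matrix `G = F₂ᵀ A^{-1/2}` satisfies `G A Gᵀ = 1` and `G T Gᵀ = diag(μ⁻²)`, and
`F = Gᵀ diag((1-σ)^{1/2})` (`simultaneous_diagonalization`). In the coordinates given by `F` the
reduced ground state is thus a product of one-dimensional Mehler kernels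
`exp(-(x²+y²)/2 - σ_j x y)`, and its diagonal entries factorize (`transformedEntry_ground`). For an
excited state, parity of the Hermite functions removes the mixed terms of the squares
(`integral_sq_sum_mul_prod`), which leaves the second moments of `x ± y` in a single mode
(`transformedEntry_single`).

The one-dimensional moments need no spectral theory of the Mehler kernel. The product of the kernel
with the two Gaussians `exp(-κx²/2)`, `exp(-κy²/2)`, where `κ² + σ² = 1`, is a Gaussian density with
covariance `(2κ)⁻¹ [[1, r], [r, 1]]`, `r = -σ/(1+κ) = (μ-1)/(μ+1)`. Integration by parts with the
recursion of the Hermite polynomials yields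
`E[H_{n+1}(√κ x) H_m(√κ y)] = 2 r m E[H_n(√κ x) H_{m-1}(√κ y)]` (`mehlerMoment_hermite_succ`), so
that these polynomials are biorthogonal with diagonal moments proportional to `2ⁿ n! rⁿ`.

The constant term of the excited entries and the bounds on the weights come from the block form of
`h^{1/2} V = V diag(γ)`: with `N` the matrix of columns `ν_k`, one has `T = N diag(γ) Nᵀ` and
`(Nᵀ T⁻¹ N + Voutᵀ B⁻¹ Vout) diag(γ) = 1`, where `Vout` has the columns `o_k`
(`schurComplement_eq`, `nuMatrix_schurComplement_inv_add`).
-/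

noncomputable section

namespace CoupledOscillators

/-! ### Second moments of product densities -/

section ProductMoments

variable {ι E : Type*} [Fintype ι]

/-- Since only the `i`-th factor is affected, an integrand `ℓ_i(z_i) ∏_j G_j(z_j)` is again a
product. -/
lemma prod_mul_apply_eq [DecidableEq ι] (G ℓ : ι → E → ℝ) (i : ι) (z : ι → E) :
    ℓ i (z i) * ∏ j, G j (z j) = ∏ j, (if j = i then ℓ j (z j) * G j (z j) else G j (z j)) := by
  rw [← Finset.mul_prod_erase _ _ (Finset.mem_univ i), ← Finset.mul_prod_erase
    (Finset.univ : Finset ι) (fun j => if j = i then _ else _) (Finset.mem_univ i)]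
  rw [if_pos rfl, mul_assoc]
  congr 2
  refine Finset.prod_congr rfl fun j hj => ?_
  rw [if_neg (Finset.ne_of_mem_erase hj)]

/-- The integrand `ℓ_i(z_i) ℓ_k(z_k) ∏_j G_j(z_j)`, with the factor `ℓ_k` absorbed in the
product. -/
lemma apply_mul_apply_mul_prod_eq [DecidableEq ι] (G ℓ : ι → E → ℝ) (i k : ι) (z : ι → E) :
    ℓ i (z i) * (ℓ k (z k) * ∏ j, G j (z j))
      = ℓ i (z i) * ∏ j, (if j = k then ℓ j (z j) * G j (z j) else G j (z j)) := by
  rw [prod_mul_apply_eq]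

lemma sq_sum_mul_prod_eq (G ℓ : ι → E → ℝ) (c : ι → ℝ) (z : ι → E) :
    (∑ i, c i * ℓ i (z i)) ^ 2 * ∏ j, G j (z j)
      = ∑ i, ∑ k, c i * c k * (ℓ i (z i) * (ℓ k (z k) * ∏ j, G j (z j))) := by
  rw [sq, Finset.sum_mul_sum, Finset.sum_mul]
  refine Finset.sum_congr rfl fun i _ => ?_
  rw [Finset.sum_mul]
  exact Finset.sum_congr rfl fun k _ => by ring

variable [MeasureSpace E] [SigmaFinite (volume : Measure E)]

lemma integrable_apply_mul_prod {G ℓ : ι → E → ℝ} (hG : ∀ i, Integrable (G i))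
    (hℓ : ∀ i, Integrable (fun z => ℓ i z * G i z)) (i : ι) :
    Integrable (fun z : ι → E => ℓ i (z i) * ∏ j, G j (z j)) := by
  classical
  simp_rw [prod_mul_apply_eq]
  refine Integrable.fintype_prod (μ := fun _ : ι => (volume : Measure E))
    (f := fun j w => if j = i then ℓ j w * G j w else G j w) fun j => ?_
  by_cases h : j = i
  · simpa [h] using hℓ i
  · simpa [h] using hG j

lemma integral_apply_mul_prod [DecidableEq ι] (G ℓ : ι → E → ℝ) (i : ι) :
    ∫ z : ι → E, ℓ i (z i) * ∏ j, G j (z j)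
      = (∫ z, ℓ i z * G i z) * ∏ j ∈ Finset.univ.erase i, ∫ z, G j z := by
  simp_rw [prod_mul_apply_eq]
  rw [integral_fintype_prod_volume_eq_prod (fun j w => if j = i then ℓ j w * G j w else G j w),
    ← Finset.mul_prod_erase _ _ (Finset.mem_univ i)]
  simp only [if_true]
  congr 1
  refine Finset.prod_congr rfl fun j hj => ?_
  simp only [if_neg (Finset.ne_of_mem_erase hj)]

lemma integrable_apply_mul_apply_mul_prod {G ℓ : ι → E → ℝ} (hG : ∀ i, Integrable (G i))
    (hℓ : ∀ i, Integrable (fun z => ℓ i z * G i z))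
    (hℓ2 : ∀ i, Integrable (fun z => ℓ i z ^ 2 * G i z)) (i k : ι) :
    Integrable (fun z : ι → E => ℓ i (z i) * (ℓ k (z k) * ∏ j, G j (z j))) := by
  classical
  by_cases hik : i = k
  · subst hik
    have := integrable_apply_mul_prod (ℓ := fun i z => ℓ i z ^ 2) hG hℓ2 i
    refine this.congr (Filter.Eventually.of_forall fun z => ?_)
    simp only
    ring
  · simp_rw [apply_mul_apply_mul_prod_eq]
    simp_rw [prod_mul_apply_eq (fun j w => if j = k then ℓ j w * G j w else G j w) ℓ]
    refine Integrable.fintype_prod (μ := fun _ : ι => (volume : Measure E))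
      (f := fun j w => if j = i then ℓ j w * (if j = k then ℓ j w * G j w else G j w)
        else (if j = k then ℓ j w * G j w else G j w)) fun j => ?_
    by_cases h : j = i
    · subst h; simpa [hik] using hℓ j
    · by_cases h' : j = k
      · subst h'; simpa [h] using hℓ j
      · simpa [h, h'] using hG j

lemma integral_apply_mul_apply_mul_prod_of_ne (G ℓ : ι → E → ℝ)
    (h0 : ∀ i, ∫ z, ℓ i z * G i z = 0) {i k : ι} (hik : i ≠ k) :
    ∫ z : ι → E, ℓ i (z i) * (ℓ k (z k) * ∏ j, G j (z j)) = 0 := by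
  classical
  simp_rw [apply_mul_apply_mul_prod_eq]
  rw [integral_apply_mul_prod (fun j w => if j = k then ℓ j w * G j w else G j w) ℓ i]
  simp [hik, h0]

lemma integrable_sum_mul_prod {G ℓ : ι → E → ℝ} (hG : ∀ i, Integrable (G i))
    (hℓ : ∀ i, Integrable (fun z => ℓ i z * G i z)) (c : ι → ℝ) :
    Integrable (fun z : ι → E => (∑ i, c i * ℓ i (z i)) * ∏ j, G j (z j)) := by
  simp_rw [Finset.sum_mul, mul_assoc]
  exact integrable_finsetSum _ fun i _ => (integrable_apply_mul_prod hG hℓ i).const_mul _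

lemma integral_sum_mul_prod {G ℓ : ι → E → ℝ} (hG : ∀ i, Integrable (G i))
    (hℓ : ∀ i, Integrable (fun z => ℓ i z * G i z)) (h0 : ∀ i, ∫ z, ℓ i z * G i z = 0)
    (c : ι → ℝ) :
    ∫ z : ι → E, (∑ i, c i * ℓ i (z i)) * ∏ j, G j (z j) = 0 := by
  classical
  simp_rw [Finset.sum_mul, mul_assoc]
  rw [integral_finsetSum _ fun i _ => (integrable_apply_mul_prod hG hℓ i).const_mul _]
  refine Finset.sum_eq_zero fun i _ => ?_
  rw [integral_const_mul, integral_apply_mul_prod, h0]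
  simp

lemma integrable_sq_sum_mul_prod {G ℓ : ι → E → ℝ} (hG : ∀ i, Integrable (G i))
    (hℓ : ∀ i, Integrable (fun z => ℓ i z * G i z))
    (hℓ2 : ∀ i, Integrable (fun z => ℓ i z ^ 2 * G i z)) (c : ι → ℝ) :
    Integrable (fun z : ι → E => (∑ i, c i * ℓ i (z i)) ^ 2 * ∏ j, G j (z j)) := by
  simp_rw [sq_sum_mul_prod_eq]
  exact integrable_finsetSum _ fun i _ => integrable_finsetSum _ fun k _ =>
    (integrable_apply_mul_apply_mul_prod hG hℓ hℓ2 i k).const_mul _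

/-- The second moment of a linear combination of independent centered functions: the mixed terms
vanish. -/
lemma integral_sq_sum_mul_prod [DecidableEq ι] {G ℓ : ι → E → ℝ} (hG : ∀ i, Integrable (G i))
    (hℓ : ∀ i, Integrable (fun z => ℓ i z * G i z))
    (hℓ2 : ∀ i, Integrable (fun z => ℓ i z ^ 2 * G i z)) (h0 : ∀ i, ∫ z, ℓ i z * G i z = 0)
    (c : ι → ℝ) :
    ∫ z : ι → E, (∑ i, c i * ℓ i (z i)) ^ 2 * ∏ j, G j (z j)
      = ∑ i, c i ^ 2 * ((∫ z, ℓ i z ^ 2 * G i z) * ∏ j ∈ Finset.univ.erase i, ∫ z, G j z) := by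
  simp_rw [sq_sum_mul_prod_eq]
  have hI := fun i k => (integrable_apply_mul_apply_mul_prod hG hℓ hℓ2 i k).const_mul (c i * c k)
  rw [integral_finsetSum _ fun i _ => integrable_finsetSum _ fun k _ => hI i k]
  refine Finset.sum_congr rfl fun i _ => ?_
  rw [integral_finsetSum _ fun k _ => hI i k, Finset.sum_eq_single i]
  · rw [integral_const_mul, ← integral_apply_mul_prod G (fun i z => ℓ i z ^ 2) i, sq]
    congr 1
    refine integral_congr_ae (Filter.Eventually.of_forall fun z => ?_)
    simp only
    ring
  · intro k _ hk
    rw [integral_const_mul, integral_apply_mul_apply_mul_prod_of_ne G ℓ h0 hk.symm, mul_zero]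
  · simp

end ProductMoments

/-! ### Powers of symmetric matrices -/

section MatrixPowers

variable {ι : Type*} [Fintype ι] [DecidableEq ι]

lemma orthogonal_mul_transpose {U : Matrix ι ι ℝ} (hU : U ∈ orthogonalGroup ι ℝ) :
    U * Uᵀ = 1 := by
  simpa [star_eq_conjTranspose, conjTranspose_eq_transpose_of_trivial] using
    (mem_orthogonalGroup_iff ι ℝ).1 hU

lemma orthogonal_transpose_mul {U : Matrix ι ι ℝ} (hU : U ∈ orthogonalGroup ι ℝ) :
    Uᵀ * U = 1 := by
  simpa [star_eq_conjTranspose, conjTranspose_eq_transpose_of_trivial] using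
    (mem_orthogonalGroup_iff' ι ℝ).1 hU

lemma orthogonal_diagonal_mul {U : Matrix ι ι ℝ} (hU : U ∈ orthogonalGroup ι ℝ) (d e : ι → ℝ) :
    U * diagonal d * Uᵀ * (U * diagonal e * Uᵀ) = U * diagonal (fun i => d i * e i) * Uᵀ := by
  calc _ = U * diagonal d * (Uᵀ * U) * diagonal e * Uᵀ := by simp only [Matrix.mul_assoc]
    _ = _ := by rw [orthogonal_transpose_mul hU, Matrix.mul_one, Matrix.mul_assoc U,
        diagonal_mul_diagonal]

lemma transpose_orthogonal_diagonal (U : Matrix ι ι ℝ) (d : ι → ℝ) :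
    (U * diagonal d * Uᵀ)ᵀ = U * diagonal d * Uᵀ := by
  simp [Matrix.transpose_mul, Matrix.mul_assoc]

lemma det_orthogonal_diagonal {U : Matrix ι ι ℝ} (hU : U ∈ orthogonalGroup ι ℝ) (d : ι → ℝ) :
    (U * diagonal d * Uᵀ).det = ∏ i, d i := by
  have h : U.det * Uᵀ.det = 1 := by rw [← det_mul, orthogonal_mul_transpose hU, det_one]
  rw [det_mul, det_mul, mul_right_comm, h, one_mul, det_diagonal]

lemma orthogonal_diagonal_const {U : Matrix ι ι ℝ} (hU : U ∈ orthogonalGroup ι ℝ) :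
    U * diagonal (fun _ => (1 : ℝ)) * Uᵀ = 1 := by
  rw [diagonal_one, Matrix.mul_one, orthogonal_mul_transpose hU]

open Polynomial in
lemma aeval_orthogonal_diagonal {U : Matrix ι ι ℝ} (hU : U ∈ orthogonalGroup ι ℝ) (d : ι → ℝ)
    (q : ℝ[X]) :
    aeval (U * diagonal d * Uᵀ) q = U * diagonal (fun i => q.eval (d i)) * Uᵀ := by
  induction q using Polynomial.induction_on' with
  | add p q hp hq =>
    rw [map_add, hp, hq, ← Matrix.add_mul, ← Matrix.mul_add, diagonal_add]
    simp
  | monomial n a =>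
    have hpow : ∀ n : ℕ, (U * diagonal d * Uᵀ) ^ n = U * diagonal (fun i => d i ^ n) * Uᵀ := by
      intro n
      induction n with
      | zero => simp [orthogonal_mul_transpose hU]
      | succ n ih =>
        rw [pow_succ, ih, orthogonal_diagonal_mul hU]
        simp [pow_succ]
    rw [aeval_monomial, hpow, Algebra.algebraMap_eq_smul_one, smul_mul_assoc, one_mul]
    have : diagonal (fun i => (monomial n a).eval (d i)) = a • diagonal (fun i => d i ^ n) := by
      rw [← diagonal_smul]
      congr 1
      ext i
      simp
    rw [this]
    simp

/-- The functional calculus acts on the eigenvalues in an orthogonal diagonalization; every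
function agrees with a polynomial on the spectrum. -/
lemma cfc_orthogonal_diagonal {U : Matrix ι ι ℝ} (hU : U ∈ orthogonalGroup ι ℝ) (d : ι → ℝ)
    (f : ℝ → ℝ) :
    cfc f (U * diagonal d * Uᵀ) = U * diagonal (fun i => f (d i)) * Uᵀ := by
  classical
  set M := U * diagonal d * Uᵀ with hM
  have hsa : IsSelfAdjoint M := by
    rw [IsSelfAdjoint, star_eq_conjTranspose, conjTranspose_eq_transpose_of_trivial,
      hM, transpose_orthogonal_diagonal]
  set q : Polynomial ℝ := Lagrange.interpolate (Finset.univ.image d) id f with hq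
  have hqd : ∀ i, q.eval (d i) = f (d i) := fun i =>
    Lagrange.eval_interpolate_at_node f (Function.injective_id.injOn)
      (Finset.mem_image_of_mem d (Finset.mem_univ i))
  have hspec : spectrum ℝ M ⊆ Set.range d := by
    intro t ht
    by_contra hcon
    have hne : ∀ i, t - d i ≠ 0 := fun i h0 => hcon ⟨i, by linarith⟩
    apply ht
    have h1 : algebraMap ℝ (Matrix ι ι ℝ) t - M = U * diagonal (fun i => t - d i) * Uᵀ := by
      have : diagonal (fun i => t - d i) = t • (1 : Matrix ι ι ℝ) - diagonal d := by
        rw [← diagonal_one, ← diagonal_smul, diagonal_sub]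
        simp
      rw [this, Matrix.mul_sub, Matrix.sub_mul, Algebra.algebraMap_eq_smul_one, hM]
      simp [orthogonal_mul_transpose hU]
    change IsUnit (algebraMap ℝ (Matrix ι ι ℝ) t - M)
    rw [h1, Matrix.isUnit_iff_isUnit_det, det_orthogonal_diagonal hU]
    exact (Finset.prod_ne_zero_iff.2 fun i _ => hne i).isUnit
  have hcongr : cfc f M = cfc q.eval M := by
    refine cfc_congr fun t ht => ?_
    obtain ⟨i, rfl⟩ := hspec ht
    exact (hqd i).symm
  rw [hcongr, cfc_polynomial q M hsa, hM, aeval_orthogonal_diagonal hU]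
  simp [hqd]

lemma matPow_orthogonal_diagonal {U : Matrix ι ι ℝ} (hU : U ∈ orthogonalGroup ι ℝ) (d : ι → ℝ)
    (p : ℝ) :
    matPow (U * diagonal d * Uᵀ) p = U * diagonal (fun i => d i ^ p) * Uᵀ :=
  cfc_orthogonal_diagonal hU d _

lemma exists_orthogonal_diagonal {M : Matrix ι ι ℝ} (hM : M.PosDef) :
    ∃ U ∈ orthogonalGroup ι ℝ, ∃ d : ι → ℝ, (∀ i, 0 < d i) ∧ M = U * diagonal d * Uᵀ := by
  refine ⟨hM.isHermitian.eigenvectorUnitary, hM.isHermitian.eigenvectorUnitary.2,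
    hM.isHermitian.eigenvalues, hM.eigenvalues_pos, ?_⟩
  have := hM.isHermitian.spectral_theorem
  rw [Unitary.conjStarAlgAut_apply] at this
  simpa [star_eq_conjTranspose, conjTranspose_eq_transpose_of_trivial, Function.comp_def] using this

/-- The inverse square root of a positive definite matrix is symmetric, has positive determinant,
and transforms the matrix to the identity. -/
lemma matPow_neg_half_spec {M : Matrix ι ι ℝ} (hM : M.PosDef) :
    (matPow M (-(1 / 2)))ᵀ = matPow M (-(1 / 2)) ∧
    matPow M (-(1 / 2)) * M * matPow M (-(1 / 2)) = 1 ∧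
    0 < (matPow M (-(1 / 2))).det := by
  obtain ⟨U, hU, d, hd, rfl⟩ := exists_orthogonal_diagonal hM
  rw [matPow_orthogonal_diagonal hU]
  refine ⟨transpose_orthogonal_diagonal _ _, ?_, ?_⟩
  · rw [orthogonal_diagonal_mul hU, orthogonal_diagonal_mul hU]
    have : (fun i => d i ^ (-(1 / 2) : ℝ) * d i * d i ^ (-(1 / 2) : ℝ)) = fun _ => (1 : ℝ) := by
      ext i
      rw [mul_right_comm, ← Real.rpow_add (hd i)]
      norm_num [Real.rpow_neg_one, (hd i).ne']
    rw [this, orthogonal_diagonal_const hU]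
  · rw [det_orthogonal_diagonal hU]
    exact Finset.prod_pos fun i _ => Real.rpow_pos_of_pos (hd i) _

/-- A positive definite matrix is congruent to the identity. -/
lemma exists_transpose_mul_mul_eq_one {M : Matrix ι ι ℝ} (hM : M.PosDef) :
    ∃ R : Matrix ι ι ℝ, Rᵀ * M * R = 1 ∧ 0 < R.det := by
  obtain ⟨h1, h2, h3⟩ := matPow_neg_half_spec hM
  exact ⟨matPow M (-(1 / 2)), by rw [h1, h2], h3⟩

end MatrixPowers

/-! ### Hermite polynomials -/

section Hermite

open Polynomial

/-- The physicists' Hermite polynomials, by the recursion `H_{n+1} = 2 X H_n - H_n'`. -/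
def hermitePoly : ℕ → ℝ[X]
  | 0 => 1
  | n + 1 => 2 * X * hermitePoly n - derivative (hermitePoly n)

lemma iteratedDeriv_gaussian (n : ℕ) :
    iteratedDeriv n (fun t : ℝ => Real.exp (-t ^ 2))
      = fun y => (-1) ^ n * (hermitePoly n).eval y * Real.exp (-y ^ 2) := by
  induction n with
  | zero => simp [hermitePoly]
  | succ n ih =>
    rw [iteratedDeriv_succ, ih]
    ext y
    have h1 : HasDerivAt (fun y : ℝ => Real.exp (-y ^ 2)) (Real.exp (-y ^ 2) * -(2 * y)) y := by
      have := ((hasDerivAt_id y).pow 2).neg.exp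
      simpa using this
    have h2 := (((hermitePoly n).hasDerivAt y).const_mul ((-1 : ℝ) ^ n)).mul h1
    rw [show (fun y => (-1 : ℝ) ^ n * (hermitePoly n).eval y * Real.exp (-y ^ 2))
      = (fun y => (-1 : ℝ) ^ n * (hermitePoly n).eval y) * (fun y => Real.exp (-y ^ 2)) from rfl,
      h2.deriv]
    simp only [hermitePoly, eval_sub, eval_mul, eval_ofNat, eval_X]
    ring

lemma hermiteH_eq_eval (n : ℕ) (y : ℝ) : hermiteH n y = (hermitePoly n).eval y := by
  have h1 : ((-1 : ℝ) ^ n) * (-1) ^ n = 1 := by rw [← mul_pow]; simp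
  have h2 : Real.exp (y ^ 2) * Real.exp (-y ^ 2) = 1 := by rw [← Real.exp_add]; simp
  rw [hermiteH, iteratedDeriv_gaussian]
  linear_combination (hermitePoly n).eval y * Real.exp (y ^ 2) * Real.exp (-y ^ 2) * h1
    + (hermitePoly n).eval y * h2

lemma derivative_hermitePoly_succ (n : ℕ) :
    derivative (hermitePoly (n + 1)) = (2 * (n + 1) : ℝ[X]) * hermitePoly n := by
  induction n with
  | zero => simp [hermitePoly]
  | succ n ih =>
    rw [hermitePoly, derivative_sub, derivative_mul, ih]
    simp only [derivative_mul, derivative_add, derivative_natCast, derivative_X, derivative_one,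
      derivative_ofNat]
    rw [show hermitePoly (n + 1) = 2 * X * hermitePoly n - derivative (hermitePoly n) from rfl]
    push_cast
    ring

/-- The rescaled Hermite polynomials `H_n(s y)`. -/
def hermiteScaled (s : ℝ) (n : ℕ) : ℝ[X] := (hermitePoly n).comp (C s * X)

lemma derivative_hermiteScaled (s : ℝ) (n : ℕ) :
    derivative (hermiteScaled s n) = C (2 * n * s) * hermiteScaled s (n - 1) := by
  cases n with
  | zero => simp [hermiteScaled, hermitePoly]
  | succ n =>
    rw [hermiteScaled, derivative_comp, derivative_hermitePoly_succ, hermiteScaled]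
    simp only [derivative_mul, derivative_C, derivative_X, mul_comp, add_comp, natCast_comp,
      one_comp, ofNat_comp, add_tsub_cancel_right]
    simp only [map_mul, map_natCast, Nat.cast_add, Nat.cast_one, map_add, map_one, map_ofNat]
    ring

/-- The three-term recursion. For `n = 0` the term of `H_{n-1}`, with truncated subtraction, has the
coefficient zero. -/
lemma X_mul_hermiteScaled (s : ℝ) (n : ℕ) :
    C s * X * hermiteScaled s n
      = C (1 / 2) * hermiteScaled s (n + 1) + C (n : ℝ) * hermiteScaled s (n - 1) := by
  have h2 : (C (1 / 2) * 2 : ℝ[X]) = 1 := by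
    rw [← C_ofNat, ← C_mul]; norm_num
  have hd : (derivative (hermitePoly n)).comp (C s * X)
      = C (2 * n : ℝ) * hermiteScaled s (n - 1) := by
    cases n with
    | zero => simp [hermitePoly]
    | succ n =>
      rw [derivative_hermitePoly_succ, hermiteScaled]
      simp only [mul_comp, add_comp, natCast_comp, one_comp, ofNat_comp, add_tsub_cancel_right,
        map_mul, map_natCast, Nat.cast_add, Nat.cast_one, map_add, map_one, map_ofNat]
      norm_cast
  have hs : hermiteScaled s (n + 1)
      = 2 * (C s * X) * hermiteScaled s n - C (2 * n : ℝ) * hermiteScaled s (n - 1) := by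
    rw [← hd, hermiteScaled, hermiteScaled]
    simp [hermitePoly]
  rw [hs]
  simp only [map_mul, map_ofNat]
  linear_combination (-(C s * X * hermiteScaled s n) + C (n : ℝ) * hermiteScaled s (n - 1)) * h2

end Hermite

/-! ### Moments of a two-dimensional Gaussian density -/

section MehlerMoments

open Polynomial

lemma integrable_polynomial_mul_exp {b : ℝ} (hb : 0 < b) (p : ℝ[X]) :
    Integrable (fun x : ℝ => p.eval x * Real.exp (-b * x ^ 2)) := by
  induction p using Polynomial.induction_on' with
  | add p q hp hq =>
    refine (hp.add hq).congr (Filter.Eventually.of_forall fun x => ?_)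
    simp [add_mul]
  | monomial n a =>
    have h := (integrable_rpow_mul_exp_neg_mul_sq hb (s := n)
      (lt_of_lt_of_le (by norm_num) n.cast_nonneg)).const_mul a
    refine h.congr (Filter.Eventually.of_forall fun x => ?_)
    simp [mul_assoc]

/-- The density `exp(-(1+κ)(x²+y²)/2 - σxy)`: the product of the Mehler kernel
`exp(-(x²+y²)/2 - σxy)` and the Gaussians `exp(-κx²/2)`, `exp(-κy²/2)`. -/
def mehlerDensity (κ σ : ℝ) (z : ℝ × ℝ) : ℝ :=
  Real.exp (-(1 / 2) * (1 + κ) * (z.1 ^ 2 + z.2 ^ 2) - σ * z.1 * z.2)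

/-- The mixed moment of `p(x) q(y)` in the density `mehlerDensity`, which is not normalized. -/
def mehlerMoment (κ σ : ℝ) (p q : ℝ[X]) : ℝ :=
  ∫ z : ℝ × ℝ, p.eval z.1 * q.eval z.2 * mehlerDensity κ σ z

lemma integrable_mehler {κ σ : ℝ} (hκ : 0 < κ) (hσ : |σ| ≤ 1) (p q : ℝ[X]) :
    Integrable (fun z : ℝ × ℝ => p.eval z.1 * q.eval z.2 * mehlerDensity κ σ z) := by
  have hb : 0 < κ / 2 := by positivity
  have h := (integrable_polynomial_mul_exp hb p).mul_prod (integrable_polynomial_mul_exp hb q)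
  -- the remaining factor, the Mehler kernel, is bounded by one
  have h2 := h.bdd_mul (c := 1)
    (f := fun z : ℝ × ℝ => Real.exp (-(1 / 2) * (z.1 ^ 2 + z.2 ^ 2) - σ * z.1 * z.2))
    (by fun_prop : Continuous _).aestronglyMeasurable
    (Filter.Eventually.of_forall fun z => by
      rw [Real.norm_of_nonneg (Real.exp_nonneg _), Real.exp_le_one_iff]
      have := neg_abs_le σ
      have := le_abs_self σ
      nlinarith [sq_nonneg (z.1 + z.2), sq_nonneg (z.1 - z.2)])
  refine h2.congr (Filter.Eventually.of_forall fun z => ?_)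
  have hE : mehlerDensity κ σ z
      = Real.exp (-(1 / 2) * (z.1 ^ 2 + z.2 ^ 2) - σ * z.1 * z.2)
        * (Real.exp (-(κ / 2) * z.1 ^ 2) * Real.exp (-(κ / 2) * z.2 ^ 2)) := by
    rw [← Real.exp_add, ← Real.exp_add, mehlerDensity]
    congr 1
    ring
  simp only
  rw [hE]
  ring

section Moments

variable {κ σ : ℝ}

lemma mehlerMoment_add_left (hκ : 0 < κ) (hσ : |σ| ≤ 1) (p p' q : ℝ[X]) :
    mehlerMoment κ σ (p + p') q = mehlerMoment κ σ p q + mehlerMoment κ σ p' q := by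
  rw [mehlerMoment, mehlerMoment, mehlerMoment,
    ← integral_add (integrable_mehler hκ hσ p q) (integrable_mehler hκ hσ p' q)]
  simp only [eval_add, add_mul]

lemma mehlerMoment_C_mul_left (c : ℝ) (p q : ℝ[X]) :
    mehlerMoment κ σ (C c * p) q = c * mehlerMoment κ σ p q := by
  rw [mehlerMoment, mehlerMoment, ← integral_const_mul]
  simp only [eval_mul, eval_C, mul_assoc]

lemma mehlerMoment_comm (p q : ℝ[X]) : mehlerMoment κ σ p q = mehlerMoment κ σ q p := by
  rw [mehlerMoment, Measure.volume_eq_prod, ← integral_prod_swap, mehlerMoment,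
    Measure.volume_eq_prod]
  congr 1
  ext z
  simp only [Prod.fst_swap, Prod.snd_swap, mehlerDensity]
  rw [mul_comm (p.eval _), add_comm (z.2 ^ 2), mul_right_comm σ z.2]

lemma mehlerMoment_add_right (hκ : 0 < κ) (hσ : |σ| ≤ 1) (p q q' : ℝ[X]) :
    mehlerMoment κ σ p (q + q') = mehlerMoment κ σ p q + mehlerMoment κ σ p q' := by
  rw [mehlerMoment_comm, mehlerMoment_add_left hκ hσ, mehlerMoment_comm q, mehlerMoment_comm q']

lemma mehlerMoment_C_mul_right (c : ℝ) (p q : ℝ[X]) :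
    mehlerMoment κ σ p (C c * q) = c * mehlerMoment κ σ p q := by
  rw [mehlerMoment_comm, mehlerMoment_C_mul_left, mehlerMoment_comm]

/-- Gaussian integration by parts in the first variable. -/
lemma mehlerMoment_derivative_left (hκ : 0 < κ) (hσ : |σ| ≤ 1) (p q : ℝ[X]) :
    mehlerMoment κ σ (derivative p) q
      = (1 + κ) * mehlerMoment κ σ (X * p) q + σ * mehlerMoment κ σ p (X * q) := by
  set f' : ℝ × ℝ → ℝ := fun z =>
    (derivative p).eval z.1 * q.eval z.2 * mehlerDensity κ σ z
      - ((1 + κ) * ((X * p).eval z.1 * q.eval z.2 * mehlerDensity κ σ z)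
        + σ * (p.eval z.1 * (X * q).eval z.2 * mehlerDensity κ σ z)) with hf'
  have i1 := integrable_mehler hκ hσ (derivative p) q
  have i2 := (integrable_mehler hκ hσ (X * p) q).const_mul (1 + κ)
  have i3 := (integrable_mehler hκ hσ p (X * q)).const_mul σ
  have i23 : Integrable (fun z : ℝ × ℝ =>
      (1 + κ) * ((X * p).eval z.1 * q.eval z.2 * mehlerDensity κ σ z)
        + σ * (p.eval z.1 * (X * q).eval z.2 * mehlerDensity κ σ z)) := i2.add i3
  have hI : Integrable f' := i1.sub i23
  have hzero : ∫ z, f' z = 0 := by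
    have hI' := hI
    have hJ := integrable_mehler hκ hσ p q
    rw [Measure.volume_eq_prod] at hI' hJ
    rw [Measure.volume_eq_prod, integral_prod_symm _ hI']
    refine integral_eq_zero_of_ae ?_
    filter_upwards [hI'.prod_left_ae, hJ.prod_left_ae] with y hy1 hy2
    refine integral_eq_zero_of_hasDerivAt_of_integrable (fun x => ?_) hy1 hy2
    have hd : HasDerivAt (fun x : ℝ => mehlerDensity κ σ (x, y))
        (mehlerDensity κ σ (x, y) * (-(1 + κ) * x - σ * y)) x := by
      have := (((((hasDerivAt_id x).pow 2).add_const (y ^ 2)).const_mul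
        (-(1 / 2) * (1 + κ))).sub (((hasDerivAt_id x).const_mul σ).mul_const y)).exp
      refine this.congr_deriv ?_
      simp only [mehlerDensity, id, Pi.sub_apply, Pi.pow_apply]
      ring_nf
    refine (((p.hasDerivAt x).mul_const (q.eval y)).mul hd).congr_deriv ?_
    simp only [hf', eval_mul, eval_X]
    ring
  simp only [hf'] at hzero
  rw [integral_sub i1 i23, integral_add i2 i3, integral_const_mul,
    integral_const_mul] at hzero
  simp only [mehlerMoment]
  linarith

/-- The covariance of the density is `(2κ)⁻¹ [[1, r], [r, 1]]` with `r = -σ/(1+κ)`. -/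
lemma mehlerMoment_X_mul (hκ : 0 < κ) (hκσ : κ ^ 2 + σ ^ 2 = 1) (hσ : |σ| ≤ 1) (p q : ℝ[X]) :
    2 * κ * mehlerMoment κ σ (X * p) q
      = mehlerMoment κ σ (derivative p) q
        + -σ / (1 + κ) * mehlerMoment κ σ p (derivative q) := by
  have h1 := mehlerMoment_derivative_left hκ hσ p q
  have h2 := mehlerMoment_derivative_left hκ hσ q p
  rw [mehlerMoment_comm (derivative q), mehlerMoment_comm (X * q), mehlerMoment_comm q] at h2
  rw [h1, h2]
  have : (1 + κ) ≠ 0 := by positivity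
  field_simp
  linear_combination (mehlerMoment κ σ (X * p) q) * hκσ

/-- The recursion that makes the moments of pairs of Hermite polynomials vanish off the diagonal: in
`E[H_{n+1} H_m]` integration by parts cancels the derivative of `H_n` against the one in
`H_{n+1} = 2 X H_n - H_n'`, and only the derivative of `H_m` remains. -/
lemma mehlerMoment_hermite_succ (hκ : 0 < κ) (hκσ : κ ^ 2 + σ ^ 2 = 1) (hσ : |σ| ≤ 1)
    (n m : ℕ) :
    mehlerMoment κ σ (hermiteScaled (√κ) (n + 1)) (hermiteScaled (√κ) m)
      = 2 * (-σ / (1 + κ)) * m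
        * mehlerMoment κ σ (hermiteScaled (√κ) n) (hermiteScaled (√κ) (m - 1)) := by
  have hs : √κ * √κ = κ := Real.mul_self_sqrt hκ.le
  have hs0 : √κ ≠ 0 := (Real.sqrt_pos.2 hκ).ne'
  have h1 := congrArg (fun p => mehlerMoment κ σ p (hermiteScaled (√κ) m))
    (X_mul_hermiteScaled (√κ) n)
  rw [mehlerMoment_add_left hκ hσ, mehlerMoment_C_mul_left, mehlerMoment_C_mul_left, mul_assoc,
    mehlerMoment_C_mul_left] at h1
  have h2 := mehlerMoment_X_mul hκ hκσ hσ (hermiteScaled (√κ) n) (hermiteScaled (√κ) m)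
  rw [derivative_hermiteScaled, derivative_hermiteScaled, mehlerMoment_C_mul_left,
    mehlerMoment_C_mul_right] at h2
  apply mul_left_cancel₀ hs0
  set a := mehlerMoment κ σ (X * hermiteScaled (√κ) n) (hermiteScaled (√κ) m)
  linear_combination (-2 * √κ) * h1 + h2 + 2 * a * hs

lemma mehlerMoment_hermite_self (hκ : 0 < κ) (hκσ : κ ^ 2 + σ ^ 2 = 1) (hσ : |σ| ≤ 1) (n : ℕ) :
    mehlerMoment κ σ (hermiteScaled (√κ) n) (hermiteScaled (√κ) n)
      = 2 ^ n * n.factorial * (-σ / (1 + κ)) ^ n * mehlerMoment κ σ 1 1 := by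
  induction n with
  | zero => simp [hermiteScaled, hermitePoly]
  | succ n ih =>
    rw [mehlerMoment_hermite_succ hκ hκσ hσ, add_tsub_cancel_right, ih, Nat.factorial_succ]
    push_cast
    ring

lemma mehlerMoment_hermite_of_ne (hκ : 0 < κ) (hκσ : κ ^ 2 + σ ^ 2 = 1) (hσ : |σ| ≤ 1)
    {n m : ℕ} (hnm : n ≠ m) :
    mehlerMoment κ σ (hermiteScaled (√κ) n) (hermiteScaled (√κ) m) = 0 := by
  induction n generalizing m with
  | zero =>
    cases m with
    | zero => exact absurd rfl hnm
    | succ m => rw [mehlerMoment_comm, mehlerMoment_hermite_succ hκ hκσ hσ]; simp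
  | succ n ih =>
    rw [mehlerMoment_hermite_succ hκ hκσ hσ]
    cases m with
    | zero => simp
    | succ m => rw [add_tsub_cancel_right, ih (by omega)]; simp

lemma mehlerMoment_one (hκ : 0 < κ) (hκσ : κ ^ 2 + σ ^ 2 = 1) (hσ : |σ| ≤ 1) :
    mehlerMoment κ σ 1 1 = √(2 * Real.pi / (1 + κ)) * √(Real.pi / κ) := by
  have h := integrable_mehler hκ hσ 1 1
  have h1 : (1 + κ) ≠ 0 := by positivity
  have hinner : ∀ x : ℝ, ∫ y : ℝ, mehlerDensity κ σ (x, y)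
      = √(2 * Real.pi / (1 + κ)) * Real.exp (-κ * x ^ 2) := by
    intro x
    have hsq : ∀ y : ℝ, mehlerDensity κ σ (x, y)
        = Real.exp (-((1 + κ) / 2) * (y + σ * x / (1 + κ)) ^ 2) * Real.exp (-κ * x ^ 2) := by
      intro y
      rw [← Real.exp_add, mehlerDensity]
      congr 1
      field_simp
      linear_combination x ^ 2 * hκσ
    simp_rw [hsq]
    rw [integral_mul_const,
      integral_add_right_eq_self (fun y : ℝ => Real.exp (-((1 + κ) / 2) * y ^ 2)),
      integral_gaussian]
    congr 2
    field_simp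
  rw [mehlerMoment, Measure.volume_eq_prod]
  rw [Measure.volume_eq_prod] at h
  rw [integral_prod _ h]
  simp only [eval_one, one_mul, hinner]
  rw [integral_const_mul, integral_gaussian]

lemma mehlerMoment_X_hermite_right (hκ : 0 < κ) (hσ : |σ| ≤ 1) (n m : ℕ) :
    √κ * mehlerMoment κ σ (X * hermiteScaled (√κ) n) (hermiteScaled (√κ) m)
      = 1 / 2 * mehlerMoment κ σ (hermiteScaled (√κ) (n + 1)) (hermiteScaled (√κ) m)
        + n * mehlerMoment κ σ (hermiteScaled (√κ) (n - 1)) (hermiteScaled (√κ) m) := by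
  rw [← mehlerMoment_C_mul_left, ← mul_assoc, X_mul_hermiteScaled, mehlerMoment_add_left hκ hσ,
    mehlerMoment_C_mul_left, mehlerMoment_C_mul_left]

lemma mehlerMoment_X_hermite_self (hκ : 0 < κ) (hκσ : κ ^ 2 + σ ^ 2 = 1) (hσ : |σ| ≤ 1) (n : ℕ) :
    mehlerMoment κ σ (X * hermiteScaled (√κ) n) (hermiteScaled (√κ) n) = 0 := by
  have h := mehlerMoment_X_hermite_right (σ := σ) hκ hσ n n
  rw [mehlerMoment_hermite_of_ne hκ hκσ hσ (by omega : n + 1 ≠ n)] at h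
  have h2 : (n : ℝ) * mehlerMoment κ σ (hermiteScaled (√κ) (n - 1)) (hermiteScaled (√κ) n) = 0 := by
    cases n with
    | zero => simp
    | succ n => rw [mehlerMoment_hermite_of_ne hκ hκσ hσ (by omega)]; simp
  rw [h2] at h
  have hs0 : √κ ≠ 0 := (Real.sqrt_pos.2 hκ).ne'
  simpa [hs0] using h

lemma mehlerMoment_X_sq_hermite (hκ : 0 < κ) (hκσ : κ ^ 2 + σ ^ 2 = 1) (hσ : |σ| ≤ 1) (n : ℕ) :
    κ * mehlerMoment κ σ (X * (X * hermiteScaled (√κ) n)) (hermiteScaled (√κ) n)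
      = (n + 1 / 2) * mehlerMoment κ σ (hermiteScaled (√κ) n) (hermiteScaled (√κ) n) := by
  have hs : √κ * √κ = κ := Real.mul_self_sqrt hκ.le
  have hX : κ * mehlerMoment κ σ (X * (X * hermiteScaled (√κ) n)) (hermiteScaled (√κ) n)
      = √κ * mehlerMoment κ σ (X * (C √κ * X * hermiteScaled (√κ) n)) (hermiteScaled (√κ) n) := by
    rw [show X * (C √κ * X * hermiteScaled (√κ) n) = C √κ * (X * (X * hermiteScaled (√κ) n)) by
      ring, mehlerMoment_C_mul_left, ← mul_assoc (√κ), hs]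
  rw [hX, X_mul_hermiteScaled, mul_add, mehlerMoment_add_left hκ hσ,
    mul_left_comm X (C _), mul_left_comm X (C _), mehlerMoment_C_mul_left,
    mehlerMoment_C_mul_left]
  have h1 := mehlerMoment_X_hermite_right (σ := σ) hκ hσ (n + 1) n
  rw [mehlerMoment_hermite_of_ne hκ hκσ hσ (by omega : n + 1 + 1 ≠ n)] at h1
  have h2 := mehlerMoment_X_hermite_right (σ := σ) hκ hσ (n - 1) n
  cases n with
  | zero => simp at h1 ⊢; linear_combination (1 / 2) * h1
  | succ n =>
    have h3 : (n : ℝ) * mehlerMoment κ σ (hermiteScaled (√κ) (n - 1))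
        (hermiteScaled (√κ) (n + 1)) = 0 := by
      rw [mehlerMoment_hermite_of_ne hκ hκσ hσ (by omega)]; simp
    simp only [add_tsub_cancel_right] at h1 h2 ⊢
    rw [h3] at h2
    push_cast at h1 h2 ⊢
    linear_combination (1 / 2) * h1 + (n + 1 : ℝ) * h2

lemma mehlerMoment_X_X_hermite (hκ : 0 < κ) (hκσ : κ ^ 2 + σ ^ 2 = 1) (hσ : |σ| ≤ 1) (n : ℕ) :
    κ * mehlerMoment κ σ (X * hermiteScaled (√κ) n) (X * hermiteScaled (√κ) n)
      = 1 / 4 * mehlerMoment κ σ (hermiteScaled (√κ) (n + 1)) (hermiteScaled (√κ) (n + 1))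
        + n ^ 2 * mehlerMoment κ σ (hermiteScaled (√κ) (n - 1)) (hermiteScaled (√κ) (n - 1)) := by
  have hs : √κ * √κ = κ := Real.mul_self_sqrt hκ.le
  have hX : κ * mehlerMoment κ σ (X * hermiteScaled (√κ) n) (X * hermiteScaled (√κ) n)
      = √κ * mehlerMoment κ σ (X * hermiteScaled (√κ) n) (C √κ * X * hermiteScaled (√κ) n) := by
    rw [mul_assoc (C √κ), mehlerMoment_C_mul_right, ← mul_assoc, hs]
  rw [hX, X_mul_hermiteScaled, mehlerMoment_add_right hκ hσ,
    mehlerMoment_C_mul_right, mehlerMoment_C_mul_right]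
  have h1 := mehlerMoment_X_hermite_right (σ := σ) hκ hσ n (n + 1)
  have h2 := mehlerMoment_X_hermite_right (σ := σ) hκ hσ n (n - 1)
  rw [mehlerMoment_hermite_of_ne hκ hκσ hσ (by omega : n + 1 ≠ n - 1)] at h2
  have h3 : (n : ℝ) * mehlerMoment κ σ (hermiteScaled (√κ) (n - 1))
      (hermiteScaled (√κ) (n + 1)) = 0 := by
    rw [mehlerMoment_hermite_of_ne hκ hκσ hσ (by omega)]; simp
  rw [h3] at h1
  linear_combination (1 / 2) * h1 + (n : ℝ) * h2

end Moments

end MehlerMoments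

/-! ### Matrix elements of the Mehler kernel -/

section MehlerElements

open Polynomial

/-- The integrand of the `n`-th diagonal matrix element of the Mehler kernel
`exp(-(x²+y²)/2 - σxy)` in the basis of Hermite-Gaussian functions. -/
def mehlerElement (κ σ : ℝ) (n : ℕ) (z : ℝ × ℝ) : ℝ :=
  hermiteGauss κ n z.1 * Real.exp (-(1 / 2) * (z.1 ^ 2 + z.2 ^ 2) - σ * z.1 * z.2)
    * hermiteGauss κ n z.2

lemma rpow_quarter_mul_self {a : ℝ} (ha : 0 ≤ a) : a ^ (1 / 4 : ℝ) * a ^ (1 / 4 : ℝ) = √a := by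
  rw [← Real.rpow_add_of_nonneg ha (by norm_num) (by norm_num), Real.sqrt_eq_rpow]
  norm_num

variable {κ σ : ℝ}

lemma mehlerElement_eq (hκ : 0 < κ) (n : ℕ) (z : ℝ × ℝ) :
    mehlerElement κ σ n z = √(κ / Real.pi) / (2 ^ n * n.factorial)
      * ((hermiteScaled (√κ) n).eval z.1 * (hermiteScaled (√κ) n).eval z.2
        * mehlerDensity κ σ z) := by
  have hE : mehlerDensity κ σ z
      = Real.exp (-(1 / 2) * κ * z.1 ^ 2)
        * Real.exp (-(1 / 2) * (z.1 ^ 2 + z.2 ^ 2) - σ * z.1 * z.2)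
        * Real.exp (-(1 / 2) * κ * z.2 ^ 2) := by
    rw [← Real.exp_add, ← Real.exp_add, mehlerDensity]
    congr 1
    ring
  have hq := rpow_quarter_mul_self (div_pos hκ Real.pi_pos).le
  have hf : √(2 ^ n * (n.factorial : ℝ)) * √(2 ^ n * (n.factorial : ℝ))
      = 2 ^ n * (n.factorial : ℝ) := Real.mul_self_sqrt (by positivity)
  have hv : ∀ y, (hermiteScaled (√κ) n).eval y = hermiteH n (√κ * y) := fun y => by
    rw [hermiteH_eq_eval, hermiteScaled]; simp
  rw [hv, hv, hE, ← hq, ← hf, mehlerElement, hermiteGauss, hermiteGauss]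
  ring

lemma integrable_polynomial_mul_mehlerElement (hκ : 0 < κ) (hσ : |σ| ≤ 1) (n : ℕ) (p q : ℝ[X]) :
    Integrable (fun z : ℝ × ℝ => p.eval z.1 * q.eval z.2 * mehlerElement κ σ n z) := by
  refine ((integrable_mehler hκ hσ (p * hermiteScaled (√κ) n)
    (q * hermiteScaled (√κ) n)).const_mul (√(κ / Real.pi) / (2 ^ n * n.factorial))).congr
    (Filter.Eventually.of_forall fun z => ?_)
  simp only [mehlerElement_eq hκ, eval_mul]
  ring

lemma integral_polynomial_mul_mehlerElement (hκ : 0 < κ) (n : ℕ) (p q : ℝ[X]) :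
    ∫ z : ℝ × ℝ, p.eval z.1 * q.eval z.2 * mehlerElement κ σ n z
      = √(κ / Real.pi) / (2 ^ n * n.factorial)
        * mehlerMoment κ σ (p * hermiteScaled (√κ) n) (q * hermiteScaled (√κ) n) := by
  rw [mehlerMoment, ← integral_const_mul]
  congr 1
  ext z
  simp only [mehlerElement_eq hκ, eval_mul]
  ring

lemma integrable_mehlerElement (hκ : 0 < κ) (hσ : |σ| ≤ 1) (n : ℕ) :
    Integrable (mehlerElement κ σ n) := by
  simpa using integrable_polynomial_mul_mehlerElement hκ hσ n 1 1

lemma integrable_linear_mul_mehlerElement (hκ : 0 < κ) (hσ : |σ| ≤ 1) (n : ℕ) (ε : ℝ) :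
    Integrable (fun z : ℝ × ℝ => (z.1 + ε * z.2) * mehlerElement κ σ n z) := by
  refine ((integrable_polynomial_mul_mehlerElement hκ hσ n X 1).add
    ((integrable_polynomial_mul_mehlerElement hκ hσ n 1 X).const_mul ε)).congr
    (Filter.Eventually.of_forall fun z => ?_)
  simp only [Pi.add_apply, eval_X, eval_one]
  ring

lemma sq_linear_mul_mehlerElement_eq (n : ℕ) {ε : ℝ} (hε : ε ^ 2 = 1) (z : ℝ × ℝ) :
    (z.1 + ε * z.2) ^ 2 * mehlerElement κ σ n z
      = (X ^ 2 : ℝ[X]).eval z.1 * (1 : ℝ[X]).eval z.2 * mehlerElement κ σ n z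
        + (1 : ℝ[X]).eval z.1 * (X ^ 2 : ℝ[X]).eval z.2 * mehlerElement κ σ n z
        + 2 * ε * ((X : ℝ[X]).eval z.1 * (X : ℝ[X]).eval z.2 * mehlerElement κ σ n z) := by
  simp only [eval_X, eval_one, eval_pow]
  linear_combination (z.2 ^ 2 * mehlerElement κ σ n z) * hε

lemma integrable_sq_linear_mul_mehlerElement (hκ : 0 < κ) (hσ : |σ| ≤ 1) (n : ℕ) {ε : ℝ}
    (hε : ε ^ 2 = 1) :
    Integrable (fun z : ℝ × ℝ => (z.1 + ε * z.2) ^ 2 * mehlerElement κ σ n z) := by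
  simp_rw [sq_linear_mul_mehlerElement_eq n hε]
  exact ((integrable_polynomial_mul_mehlerElement hκ hσ n _ _).add
    (integrable_polynomial_mul_mehlerElement hκ hσ n _ _)).add
    ((integrable_polynomial_mul_mehlerElement hκ hσ n _ _).const_mul _)

lemma normalized_mehlerMoment_hermite (hκ : 0 < κ) (hκσ : κ ^ 2 + σ ^ 2 = 1) (hσ : |σ| ≤ 1)
    (n : ℕ) :
    √(κ / Real.pi) / (2 ^ n * n.factorial)
        * mehlerMoment κ σ (hermiteScaled (√κ) n) (hermiteScaled (√κ) n)
      = √(2 * Real.pi / (1 + κ)) * (-σ / (1 + κ)) ^ n := by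
  have h1 : √(κ / Real.pi) * √(Real.pi / κ) = 1 := by
    rw [← Real.sqrt_mul (div_pos hκ Real.pi_pos).le]
    rw [Real.sqrt_eq_one]
    have := Real.pi_pos.ne'
    field_simp
  rw [mehlerMoment_hermite_self hκ hκσ hσ, mehlerMoment_one hκ hκσ hσ]
  have h2 : (2 : ℝ) ^ n * n.factorial ≠ 0 := by positivity
  rw [div_mul_eq_mul_div, div_eq_iff h2]
  linear_combination (2 ^ n * n.factorial * (-σ / (1 + κ)) ^ n * √(2 * Real.pi / (1 + κ))) * h1

lemma integral_mehlerElement (hκ : 0 < κ) (hκσ : κ ^ 2 + σ ^ 2 = 1) (hσ : |σ| ≤ 1) (n : ℕ) :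
    ∫ z, mehlerElement κ σ n z = √(2 * Real.pi / (1 + κ)) * (-σ / (1 + κ)) ^ n := by
  have h := integral_polynomial_mul_mehlerElement (σ := σ) hκ n 1 1
  simp only [eval_one, one_mul] at h
  rw [h, normalized_mehlerMoment_hermite hκ hκσ hσ]

lemma integral_linear_mul_mehlerElement (hκ : 0 < κ) (hκσ : κ ^ 2 + σ ^ 2 = 1) (hσ : |σ| ≤ 1)
    (n : ℕ) (ε : ℝ) :
    ∫ z : ℝ × ℝ, (z.1 + ε * z.2) * mehlerElement κ σ n z = 0 := by
  have i1 := integrable_polynomial_mul_mehlerElement hκ hσ n X 1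
  have i2 := (integrable_polynomial_mul_mehlerElement hκ hσ n 1 X).const_mul ε
  have h1 := integral_polynomial_mul_mehlerElement (σ := σ) hκ n X 1
  have h2 := integral_polynomial_mul_mehlerElement (σ := σ) hκ n 1 X
  rw [one_mul, mehlerMoment_X_hermite_self hκ hκσ hσ, mul_zero] at h1
  rw [one_mul, mehlerMoment_comm, mehlerMoment_X_hermite_self hκ hκσ hσ, mul_zero] at h2
  have h3 := integral_add i1 i2
  rw [h1, integral_const_mul, h2, mul_zero, add_zero] at h3
  rw [← h3]
  congr 1
  ext z
  simp only [eval_X, eval_one]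
  ring

lemma integral_sq_linear_mul_mehlerElement (hκ : 0 < κ) (hκσ : κ ^ 2 + σ ^ 2 = 1) (hσ : |σ| ≤ 1)
    (n : ℕ) {ε : ℝ} (hε : ε ^ 2 = 1) :
    ∫ z : ℝ × ℝ, (z.1 + ε * z.2) ^ 2 * mehlerElement κ σ n z
      = √(2 * Real.pi / (1 + κ)) / κ * ((2 * n + 1) * (-σ / (1 + κ)) ^ n
        + ε * ((n + 1) * (-σ / (1 + κ)) ^ (n + 1) + n * (-σ / (1 + κ)) ^ (n - 1))) := by
  have i1 := integrable_polynomial_mul_mehlerElement hκ hσ n (X ^ 2) 1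
  have i2 := integrable_polynomial_mul_mehlerElement hκ hσ n 1 (X ^ 2)
  have i3 := (integrable_polynomial_mul_mehlerElement hκ hσ n X X).const_mul (2 * ε)
  simp_rw [sq_linear_mul_mehlerElement_eq n hε]
  rw [integral_add (by exact i1.add i2) i3, integral_add i1 i2, integral_const_mul,
    integral_polynomial_mul_mehlerElement hκ, integral_polynomial_mul_mehlerElement hκ,
    integral_polynomial_mul_mehlerElement hκ, one_mul,
    mehlerMoment_comm (hermiteScaled (√κ) n) (X ^ 2 * _), sq X, mul_assoc]
  have h2 := mehlerMoment_X_sq_hermite hκ hκσ hσ n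
  have h3 := mehlerMoment_X_X_hermite hκ hκσ hσ n
  have j1 := normalized_mehlerMoment_hermite hκ hκσ hσ n
  have j2 := normalized_mehlerMoment_hermite hκ hκσ hσ (n + 1)
  have j3 : √(κ / Real.pi) / (2 ^ n * n.factorial) * ((n : ℝ) ^ 2 *
      mehlerMoment κ σ (hermiteScaled (√κ) (n - 1)) (hermiteScaled (√κ) (n - 1)))
      = n / 2 * (√(2 * Real.pi / (1 + κ)) * (-σ / (1 + κ)) ^ (n - 1)) := by
    cases n with
    | zero => simp
    | succ n =>
      rw [← normalized_mehlerMoment_hermite hκ hκσ hσ (n + 1 - 1), Nat.factorial_succ,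
        add_tsub_cancel_right]
      have : ((n : ℝ) + 1) ≠ 0 := by positivity
      push_cast
      field_simp
      ring
  have j4 : √(κ / Real.pi) / (2 ^ (n + 1) * (n + 1).factorial)
      = √(κ / Real.pi) / (2 ^ n * n.factorial) / (2 * (n + 1)) := by
    rw [Nat.factorial_succ, pow_succ, div_div]
    push_cast
    ring_nf
  rw [j4] at j2
  set N := √(κ / Real.pi) / (2 ^ n * n.factorial)
  have hn : (2 * ((n : ℝ) + 1)) ≠ 0 := by positivity
  rw [div_mul_eq_mul_div, div_eq_iff hn] at j2
  rw [div_mul_eq_mul_div _ κ, eq_div_iff hκ.ne']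
  linear_combination (2 * N) * h2 + 2 * ε * N * h3 + (2 * n + 1) * j1 + (ε / 2) * j2
    + 2 * ε * j3

end MehlerElements

/-! ### Gaussian integrals in several variables -/

section GaussianIntegrals

variable {ι : Type*} [Fintype ι] [DecidableEq ι]

lemma measurableEmbedding_mulVec {R : Matrix ι ι ℝ} (hR : R.det ≠ 0) :
    MeasurableEmbedding (fun x : ι → ℝ => R *ᵥ x) :=
  (by fun_prop : Continuous fun x : ι → ℝ => R *ᵥ x).measurableEmbedding
    (Matrix.mulVec_injective_iff_isUnit.2 ((Matrix.isUnit_iff_isUnit_det R).2 hR.isUnit))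

lemma map_mulVec_volume {R : Matrix ι ι ℝ} (hR : R.det ≠ 0) :
    Measure.map (fun x : ι → ℝ => R *ᵥ x) volume = ENNReal.ofReal |R.det⁻¹| • volume :=
  Real.map_matrix_volume_pi_eq_smul_volume_pi hR

lemma integral_comp_mulVec {R : Matrix ι ι ℝ} (hR : R.det ≠ 0) (f : (ι → ℝ) → ℝ) :
    |R.det| * ∫ x, f (R *ᵥ x) = ∫ x, f x := by
  rw [← (measurableEmbedding_mulVec hR).integral_map, map_mulVec_volume hR, integral_smul_measure,
    ENNReal.toReal_ofReal (abs_nonneg _), smul_eq_mul, ← mul_assoc, abs_inv,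
    mul_inv_cancel₀ (abs_ne_zero.2 hR), one_mul]

lemma integrable_comp_mulVec_iff {R : Matrix ι ι ℝ} (hR : R.det ≠ 0) {f : (ι → ℝ) → ℝ} :
    Integrable (fun x => f (R *ᵥ x)) ↔ Integrable f := by
  have h := (measurableEmbedding_mulVec hR).integrable_map_iff (μ := volume) (g := f)
  rw [map_mulVec_volume hR, integrable_smul_measure (by simpa using hR) (by simp)] at h
  exact h.symm

lemma integral_id_mul_exp_neg_sq : ∫ t : ℝ, t * Real.exp (-1 * t ^ 2) = 0 := by
  have hd : ∀ t : ℝ, HasDerivAt (fun t : ℝ => -(1 / 2) * Real.exp (-1 * t ^ 2))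
      (t * Real.exp (-1 * t ^ 2)) t := fun t => by
    have := ((((hasDerivAt_id t).pow 2).const_mul (-1)).exp).const_mul (-(1 / 2) : ℝ)
    refine this.congr_deriv ?_
    simp only [id, Pi.pow_apply]
    ring
  exact integral_eq_zero_of_hasDerivAt_of_integrable hd (integrable_mul_exp_neg_mul_sq one_pos)
    ((integrable_exp_neg_mul_sq one_pos).const_mul _)

lemma integrable_sq_mul_exp_neg_sq : Integrable fun t : ℝ => t ^ 2 * Real.exp (-1 * t ^ 2) := by
  refine (integrable_polynomial_mul_exp one_pos (Polynomial.X ^ 2)).congr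
    (Filter.Eventually.of_forall fun t => ?_)
  simp only [Polynomial.eval_pow, Polynomial.eval_X]

lemma integral_sq_mul_exp_neg_sq : ∫ t : ℝ, t ^ 2 * Real.exp (-1 * t ^ 2) = √Real.pi / 2 := by
  have i0 := integrable_exp_neg_mul_sq one_pos
  have i1 := integrable_mul_exp_neg_mul_sq one_pos
  have i2 := integrable_sq_mul_exp_neg_sq
  have hd : ∀ t : ℝ, HasDerivAt (fun t : ℝ => t * Real.exp (-1 * t ^ 2))
      (Real.exp (-1 * t ^ 2) - 2 * (t ^ 2 * Real.exp (-1 * t ^ 2))) t := fun t => by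
    have := (hasDerivAt_id t).mul (((hasDerivAt_id t).pow 2).const_mul (-1)).exp
    refine this.congr_deriv ?_
    simp only [id, Pi.pow_apply]
    ring
  have h := integral_eq_zero_of_hasDerivAt_of_integrable hd (i0.sub (i2.const_mul 2)) i1
  rw [integral_sub i0 (i2.const_mul 2), integral_const_mul, integral_gaussian, div_one] at h
  linarith

/-- The mass `∫ exp(-wᵀ B w) dw`; note that there is no factor `1/2` in the exponent. -/
def gaussianMass (B : Matrix ι ι ℝ) : ℝ := ∫ w : ι → ℝ, Real.exp (-(w ⬝ᵥ B *ᵥ w))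

lemma exp_neg_quadratic_comp {B R : Matrix ι ι ℝ} (hR : Rᵀ * B * R = 1) (z : ι → ℝ) :
    Real.exp (-((R *ᵥ z) ⬝ᵥ B *ᵥ (R *ᵥ z))) = ∏ i, Real.exp (-1 * z i ^ 2) := by
  have h : (R *ᵥ z) ⬝ᵥ B *ᵥ (R *ᵥ z) = z ⬝ᵥ z := by
    calc _ = z ⬝ᵥ (Rᵀ * B * R) *ᵥ z := by
          rw [← Matrix.mulVec_mulVec, ← Matrix.mulVec_mulVec, Matrix.dotProduct_mulVec z Rᵀ,
            Matrix.vecMul_transpose]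
      _ = _ := by rw [hR, Matrix.one_mulVec]
  rw [h, ← Real.exp_sum, dotProduct, ← Finset.sum_neg_distrib]
  congr 1
  exact Finset.sum_congr rfl fun i _ => by ring

lemma gaussianMass_sq_mul_det {B : Matrix ι ι ℝ} (hB : B.PosDef) :
    0 < gaussianMass B ∧ gaussianMass B ^ 2 * B.det = Real.pi ^ Fintype.card ι := by
  obtain ⟨R, hR, hdet⟩ := exists_transpose_mul_mul_eq_one hB
  have hm : gaussianMass B = R.det * √Real.pi ^ Fintype.card ι := by
    rw [gaussianMass, ← integral_comp_mulVec hdet.ne', abs_of_pos hdet]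
    simp_rw [exp_neg_quadratic_comp hR]
    rw [integral_fintype_prod_volume_eq_pow (fun t : ℝ => Real.exp (-1 * t ^ 2)),
      integral_gaussian, div_one]
  have hd : R.det * B.det * R.det = 1 := by
    have := congrArg det hR
    simpa [det_mul] using this
  have hpi : √Real.pi ^ 2 = Real.pi := Real.sq_sqrt Real.pi_pos.le
  refine ⟨hm ▸ by positivity, ?_⟩
  rw [hm, mul_pow, ← pow_mul, mul_comm _ 2, pow_mul, hpi]
  linear_combination (Real.pi ^ Fintype.card ι) * hd

/-- The covariance of the density `exp(-wᵀ B w)` is `B⁻¹/2`. -/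
lemma integral_gaussian_quadratic {B : Matrix ι ι ℝ} (hB : B.PosDef) (o : ι → ℝ) (p q : ℝ) :
    Integrable (fun w : ι → ℝ => (p + o ⬝ᵥ w) * (q + o ⬝ᵥ w) * Real.exp (-(w ⬝ᵥ B *ᵥ w))) ∧
    ∫ w : ι → ℝ, (p + o ⬝ᵥ w) * (q + o ⬝ᵥ w) * Real.exp (-(w ⬝ᵥ B *ᵥ w))
      = gaussianMass B * (p * q + 1 / 2 * (o ⬝ᵥ B⁻¹ *ᵥ o)) := by
  obtain ⟨R, hR, hdet⟩ := exists_transpose_mul_mul_eq_one hB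
  have hBinv : B⁻¹ = R * Rᵀ := by
    refine Matrix.inv_eq_left_inv ?_
    rw [Matrix.mul_assoc]
    exact mul_eq_one_comm.1 hR
  set c := Rᵀ *ᵥ o with hc
  have hcc : o ⬝ᵥ B⁻¹ *ᵥ o = ∑ i, c i ^ 2 := by
    rw [hBinv, ← Matrix.mulVec_mulVec, Matrix.dotProduct_mulVec, ← Matrix.mulVec_transpose]
    exact Finset.sum_congr rfl fun i _ => (sq _).symm
  have ho : ∀ z : ι → ℝ, o ⬝ᵥ R *ᵥ z = ∑ i, c i * z i := fun z => by
    rw [Matrix.dotProduct_mulVec, ← Matrix.mulVec_transpose]; rfl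
  have i0 : ∀ _ : ι, Integrable fun t : ℝ => Real.exp (-1 * t ^ 2) :=
    fun _ => integrable_exp_neg_mul_sq one_pos
  have i1 : ∀ _ : ι, Integrable fun t : ℝ => t * Real.exp (-1 * t ^ 2) :=
    fun _ => integrable_mul_exp_neg_mul_sq one_pos
  have i2 : ∀ _ : ι, Integrable fun t : ℝ => t ^ 2 * Real.exp (-1 * t ^ 2) :=
    fun _ => integrable_sq_mul_exp_neg_sq
  have h0 : ∀ _ : ι, ∫ t : ℝ, t * Real.exp (-1 * t ^ 2) = 0 := fun _ => integral_id_mul_exp_neg_sq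
  have j0 : Integrable fun z : ι → ℝ => p * q * ∏ i, Real.exp (-1 * z i ^ 2) :=
    (Integrable.fintype_prod (μ := fun _ : ι => (volume : Measure ℝ)) i0).const_mul _
  have j1 := (integrable_sum_mul_prod (ℓ := fun _ t => t) i0 i1 c).const_mul (p + q)
  have j2 := integrable_sq_sum_mul_prod (ℓ := fun _ t => t) i0 i1 i2 c
  have hcomp : ∀ z : ι → ℝ, (p + o ⬝ᵥ R *ᵥ z) * (q + o ⬝ᵥ R *ᵥ z)
      * Real.exp (-((R *ᵥ z) ⬝ᵥ B *ᵥ (R *ᵥ z)))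
      = p * q * ∏ i, Real.exp (-1 * z i ^ 2)
        + (p + q) * ((∑ i, c i * z i) * ∏ i, Real.exp (-1 * z i ^ 2))
        + (∑ i, c i * z i) ^ 2 * ∏ i, Real.exp (-1 * z i ^ 2) := fun z => by
    rw [exp_neg_quadratic_comp hR, ho]
    ring
  constructor
  · rw [← integrable_comp_mulVec_iff hdet.ne']
    simp_rw [hcomp]
    exact (j0.add j1).add j2
  · have hmass : gaussianMass B = |R.det| * ∏ _i : ι, ∫ t : ℝ, Real.exp (-1 * t ^ 2) := by
      rw [gaussianMass, ← integral_comp_mulVec hdet.ne']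
      simp_rw [exp_neg_quadratic_comp hR]
      rw [integral_fintype_prod_volume_eq_prod (fun (_ : ι) (t : ℝ) => Real.exp (-1 * t ^ 2))]
    rw [← integral_comp_mulVec hdet.ne']
    simp_rw [hcomp]
    rw [integral_add (by exact j0.add j1) j2, integral_add j0 j1, integral_const_mul,
      integral_const_mul, integral_sum_mul_prod (ℓ := fun _ t => t) i0 i1 h0 c,
      integral_sq_sum_mul_prod (ℓ := fun _ t => t) i0 i1 i2 h0 c,
      integral_fintype_prod_volume_eq_prod (fun (_ : ι) (t : ℝ) => Real.exp (-1 * t ^ 2)),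
      hmass, hcc]
    have herase : ∀ i : ι, (∫ t : ℝ, t ^ 2 * Real.exp (-1 * t ^ 2))
        * ∏ _j ∈ Finset.univ.erase i, ∫ t : ℝ, Real.exp (-1 * t ^ 2)
        = 1 / 2 * ∏ _j : ι, ∫ t : ℝ, Real.exp (-1 * t ^ 2) := fun i => by
      rw [← Finset.mul_prod_erase Finset.univ _ (Finset.mem_univ i), integral_sq_mul_exp_neg_sq,
        integral_gaussian, div_one]
      ring
    simp_rw [herase]
    rw [← Finset.sum_mul]
    ring

/-- Completing the square: the Gaussian integral with a linear term `b` in the exponent. -/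
lemma integral_gaussian_quadratic_linear {B : Matrix ι ι ℝ} (hB : B.PosDef) (o b : ι → ℝ)
    (p q : ℝ) :
    Integrable (fun u : ι → ℝ =>
      (p + o ⬝ᵥ u) * (q + o ⬝ᵥ u) * Real.exp (-(b ⬝ᵥ u) - u ⬝ᵥ B *ᵥ u)) ∧
    ∫ u : ι → ℝ, (p + o ⬝ᵥ u) * (q + o ⬝ᵥ u) * Real.exp (-(b ⬝ᵥ u) - u ⬝ᵥ B *ᵥ u)
      = gaussianMass B * Real.exp (1 / 4 * (b ⬝ᵥ B⁻¹ *ᵥ b))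
        * ((p - 1 / 2 * (o ⬝ᵥ B⁻¹ *ᵥ b)) * (q - 1 / 2 * (o ⬝ᵥ B⁻¹ *ᵥ b))
          + 1 / 2 * (o ⬝ᵥ B⁻¹ *ᵥ o)) := by
  obtain ⟨hI, hE⟩ := integral_gaussian_quadratic hB o (p - 1 / 2 * (o ⬝ᵥ B⁻¹ *ᵥ b))
    (q - 1 / 2 * (o ⬝ᵥ B⁻¹ *ᵥ b))
  set s : ι → ℝ := (1 / 2 : ℝ) • (B⁻¹ *ᵥ b) with hs
  have hBt : Bᵀ = B := by
    simpa [Matrix.IsHermitian, conjTranspose_eq_transpose_of_trivial] using hB.isHermitian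
  have hBs : B *ᵥ s = (1 / 2 : ℝ) • b := by
    rw [hs, Matrix.mulVec_smul, Matrix.mulVec_mulVec,
      Matrix.mul_nonsing_inv B ((Matrix.isUnit_iff_isUnit_det B).1 hB.isUnit), Matrix.one_mulVec]
  have hos : o ⬝ᵥ s = 1 / 2 * (o ⬝ᵥ B⁻¹ *ᵥ b) := by rw [hs, dotProduct_smul, smul_eq_mul]
  have hbs : b ⬝ᵥ s = 1 / 2 * (b ⬝ᵥ B⁻¹ *ᵥ b) := by rw [hs, dotProduct_smul, smul_eq_mul]
  have hshift : ∀ u : ι → ℝ,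
      (p + o ⬝ᵥ u) * (q + o ⬝ᵥ u) * Real.exp (-(b ⬝ᵥ u) - u ⬝ᵥ B *ᵥ u)
      = Real.exp (1 / 4 * (b ⬝ᵥ B⁻¹ *ᵥ b))
        * ((p - 1 / 2 * (o ⬝ᵥ B⁻¹ *ᵥ b) + o ⬝ᵥ (u + s))
          * (q - 1 / 2 * (o ⬝ᵥ B⁻¹ *ᵥ b) + o ⬝ᵥ (u + s))
          * Real.exp (-((u + s) ⬝ᵥ B *ᵥ (u + s)))) := fun u => by
    have hsB : s ⬝ᵥ B *ᵥ u = (1 / 2) * (b ⬝ᵥ u) := by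
      rw [Matrix.dotProduct_mulVec, ← Matrix.mulVec_transpose, hBt, hBs, smul_dotProduct,
        smul_eq_mul]
    have hq : (u + s) ⬝ᵥ B *ᵥ (u + s)
        = u ⬝ᵥ B *ᵥ u + b ⬝ᵥ u + 1 / 4 * (b ⬝ᵥ B⁻¹ *ᵥ b) := by
      rw [Matrix.mulVec_add, dotProduct_add, add_dotProduct, add_dotProduct, hsB, hBs,
        dotProduct_smul, dotProduct_smul, dotProduct_comm u b, dotProduct_comm s b, hbs,
        smul_eq_mul, smul_eq_mul]
      ring
    rw [hq, dotProduct_add, hos]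
    have hexp : Real.exp (-(b ⬝ᵥ u) - u ⬝ᵥ B *ᵥ u) = Real.exp (1 / 4 * (b ⬝ᵥ B⁻¹ *ᵥ b))
        * Real.exp (-(u ⬝ᵥ B *ᵥ u + b ⬝ᵥ u + 1 / 4 * (b ⬝ᵥ B⁻¹ *ᵥ b))) := by
      rw [← Real.exp_add]
      congr 1
      ring
    rw [hexp]
    ring
  simp_rw [hshift]
  refine ⟨(hI.comp_add_right s).const_mul _, ?_⟩
  rw [integral_const_mul, integral_add_right_eq_self (fun w : ι → ℝ =>
    (p - 1 / 2 * (o ⬝ᵥ B⁻¹ *ᵥ b) + o ⬝ᵥ w) * (q - 1 / 2 * (o ⬝ᵥ B⁻¹ *ᵥ b) + o ⬝ᵥ w)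
      * Real.exp (-(w ⬝ᵥ B *ᵥ w))), hE]
  ring

end GaussianIntegrals

/-! ### The blocks of `h^{1/2}` -/

section Blocks

variable {Λ : Type*} [Fintype Λ] [DecidableEq Λ] (Λ₀ : Finset Λ)

/-- The rows of `V` in `Λ₀`; its columns are the vectors `(v_k)_{Λ₀}`. -/
def rowsIn (V : Matrix Λ Λ ℝ) : Matrix {i // i ∈ Λ₀} Λ ℝ := V.submatrix Subtype.val id

/-- The rows of `V` outside `Λ₀`; its columns are the vectors `(v_k)_{Λ∖Λ₀}`. -/
def rowsOut (V : Matrix Λ Λ ℝ) : Matrix {i // i ∉ Λ₀} Λ ℝ := V.submatrix Subtype.val id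

/-- The Schur complement `A - C B⁻¹ Cᵀ` of the block `B` in `h^{1/2}`. -/
def schurComplement (h : Matrix Λ Λ ℝ) : Matrix {i // i ∈ Λ₀} {i // i ∈ Λ₀} ℝ :=
  blockA Λ₀ h - blockCBC Λ₀ h

/-- The matrix with columns `ν_k`. -/
def nuMatrix (h V : Matrix Λ Λ ℝ) : Matrix {i // i ∈ Λ₀} Λ ℝ :=
  rowsIn Λ₀ V - blockC Λ₀ h * (blockB Λ₀ h)⁻¹ * rowsOut Λ₀ V

omit [Fintype Λ] [DecidableEq Λ] in
lemma sq_diagonal_rpow_half {γ : Λ → ℝ} (hγ : ∀ k, 0 < γ k) :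
    (fun k => (γ k ^ 2) ^ (1 / 2 : ℝ)) = γ := by
  ext k
  rw [← Real.sqrt_eq_rpow, Real.sqrt_sq (hγ k).le]

/-- A matrix `X D Xᵀ` with `D` diagonal, positive and `X` of full row rank is positive definite. -/
lemma posDef_mul_diagonal_mul_transpose {κ : Type*} [Fintype κ] [DecidableEq κ] {γ : Λ → ℝ}
    (hγ : ∀ k, 0 < γ k) {X Y : Matrix κ Λ ℝ} (h : X * Yᵀ = 1) :
    (X * diagonal γ * Xᵀ).PosDef := by
  have hD : (diagonal γ).PosDef := Matrix.PosDef.diagonal hγ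
  have hinj : Function.Injective X.vecMul := by
    intro x y hxy
    have := congrArg (fun w => w ᵥ* Yᵀ) hxy
    simpa [Matrix.vecMul_vecMul, h] using this
  simpa [conjTranspose_eq_transpose_of_trivial] using hD.mul_mul_conjTranspose_same hinj

variable {h V : Matrix Λ Λ ℝ} {γ : Λ → ℝ} (hV : V ∈ orthogonalGroup Λ ℝ) (hγ : ∀ k, 0 < γ k)
  (hdiag : h = V * diagonal (fun k => γ k ^ 2) * Vᵀ)

section

include hV

lemma rowsIn_mul_transpose : rowsIn Λ₀ V * (rowsIn Λ₀ V)ᵀ = 1 := by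
  ext i j
  change (V * Vᵀ) i.1 j.1 = _
  rw [orthogonal_mul_transpose hV, Matrix.one_apply, Matrix.one_apply]
  simp only [Subtype.ext_iff]

lemma rowsOut_mul_transpose : rowsOut Λ₀ V * (rowsOut Λ₀ V)ᵀ = 1 := by
  ext i j
  change (V * Vᵀ) i.1 j.1 = _
  rw [orthogonal_mul_transpose hV, Matrix.one_apply, Matrix.one_apply]
  simp only [Subtype.ext_iff]

lemma rowsIn_mul_rowsOut_transpose : rowsIn Λ₀ V * (rowsOut Λ₀ V)ᵀ = 0 := by
  ext i j
  change (V * Vᵀ) i.1 j.1 = 0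
  have hij : i.1 ≠ j.1 := fun hij => j.2 (hij ▸ i.2)
  rw [orthogonal_mul_transpose hV, Matrix.one_apply_ne hij]

lemma rows_transpose_mul_add :
    (rowsIn Λ₀ V)ᵀ * rowsIn Λ₀ V + (rowsOut Λ₀ V)ᵀ * rowsOut Λ₀ V = 1 := by
  rw [← orthogonal_transpose_mul hV]
  ext k l
  simp only [Matrix.add_apply, Matrix.mul_apply, rowsIn, rowsOut, Matrix.transpose_apply,
    Matrix.submatrix_apply, id]
  convert Fintype.sum_subtype_add_sum_subtype (fun i => i ∈ Λ₀) fun i => V i k * V i l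

lemma rowsIn_mul_nuMatrix_transpose : rowsIn Λ₀ V * (nuMatrix Λ₀ h V)ᵀ = 1 := by
  rw [nuMatrix, Matrix.transpose_sub, Matrix.mul_sub, Matrix.transpose_mul, ← Matrix.mul_assoc,
    rowsIn_mul_rowsOut_transpose Λ₀ hV, Matrix.zero_mul, sub_zero, rowsIn_mul_transpose Λ₀ hV]

lemma nuMatrix_mul_rowsIn_transpose : nuMatrix Λ₀ h V * (rowsIn Λ₀ V)ᵀ = 1 := by
  rw [← Matrix.transpose_inj, Matrix.transpose_mul, Matrix.transpose_transpose,
    rowsIn_mul_nuMatrix_transpose Λ₀ hV, Matrix.transpose_one]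

end

section

include hV hγ hdiag

lemma matPow_half_eq : matPow h (1 / 2) = V * diagonal γ * Vᵀ := by
  rw [hdiag, matPow_orthogonal_diagonal hV, sq_diagonal_rpow_half hγ]

lemma blockA_eq : blockA Λ₀ h = rowsIn Λ₀ V * diagonal γ * (rowsIn Λ₀ V)ᵀ := by
  rw [blockA, matPow_half_eq hV hγ hdiag]
  rfl

lemma blockC_eq : blockC Λ₀ h = rowsIn Λ₀ V * diagonal γ * (rowsOut Λ₀ V)ᵀ := by
  rw [blockC, matPow_half_eq hV hγ hdiag]
  rfl

lemma blockB_eq : blockB Λ₀ h = rowsOut Λ₀ V * diagonal γ * (rowsOut Λ₀ V)ᵀ := by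
  rw [blockB, matPow_half_eq hV hγ hdiag]
  rfl

lemma blockA_posDef : (blockA Λ₀ h).PosDef := by
  rw [blockA_eq Λ₀ hV hγ hdiag]
  exact posDef_mul_diagonal_mul_transpose hγ (rowsIn_mul_transpose Λ₀ hV)

lemma blockB_posDef : (blockB Λ₀ h).PosDef := by
  rw [blockB_eq Λ₀ hV hγ hdiag]
  exact posDef_mul_diagonal_mul_transpose hγ (rowsOut_mul_transpose Λ₀ hV)

lemma blockB_transpose : (blockB Λ₀ h)ᵀ = blockB Λ₀ h := by
  simpa [Matrix.IsHermitian, conjTranspose_eq_transpose_of_trivial] using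
    (blockB_posDef Λ₀ hV hγ hdiag).isHermitian

lemma blockB_inv_transpose : ((blockB Λ₀ h)⁻¹)ᵀ = (blockB Λ₀ h)⁻¹ := by
  rw [Matrix.transpose_nonsing_inv, blockB_transpose Λ₀ hV hγ hdiag]

lemma blockB_isUnit_det : IsUnit (blockB Λ₀ h).det :=
  (Matrix.isUnit_iff_isUnit_det _).1 (blockB_posDef Λ₀ hV hγ hdiag).isUnit

/-- The lower block row of the eigenvalue equation `h^{1/2} V = V diag(γ)`. -/
lemma blockC_transpose_mul_rowsIn :
    (blockC Λ₀ h)ᵀ * rowsIn Λ₀ V + blockB Λ₀ h * rowsOut Λ₀ V = rowsOut Λ₀ V * diagonal γ := by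
  rw [blockC_eq Λ₀ hV hγ hdiag, blockB_eq Λ₀ hV hγ hdiag]
  simp only [Matrix.transpose_mul, Matrix.transpose_transpose, Matrix.diagonal_transpose]
  rw [← Matrix.mul_assoc (rowsOut Λ₀ V), Matrix.mul_assoc _ _ (rowsIn Λ₀ V),
    Matrix.mul_assoc _ _ (rowsOut Λ₀ V), ← Matrix.mul_add, rows_transpose_mul_add Λ₀ hV,
    Matrix.mul_one]

/-- The upper block row of the eigenvalue equation `h^{1/2} V = V diag(γ)`. -/
lemma blockA_mul_rowsIn :
    blockA Λ₀ h * rowsIn Λ₀ V + blockC Λ₀ h * rowsOut Λ₀ V = rowsIn Λ₀ V * diagonal γ := by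
  rw [blockC_eq Λ₀ hV hγ hdiag, blockA_eq Λ₀ hV hγ hdiag,
    Matrix.mul_assoc _ _ (rowsIn Λ₀ V),
    Matrix.mul_assoc _ _ (rowsOut Λ₀ V), ← Matrix.mul_add, rows_transpose_mul_add Λ₀ hV,
    Matrix.mul_one]

/-- Block elimination in the eigenvalue equation. -/
lemma schurComplement_mul_rowsIn :
    schurComplement Λ₀ h * rowsIn Λ₀ V = nuMatrix Λ₀ h V * diagonal γ := by
  have h1 := blockA_mul_rowsIn Λ₀ hV hγ hdiag
  have h2 := blockC_transpose_mul_rowsIn Λ₀ hV hγ hdiag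
  have hB := Matrix.nonsing_inv_mul _ (blockB_isUnit_det Λ₀ hV hγ hdiag)
  have h3 : blockCBC Λ₀ h * rowsIn Λ₀ V
      = blockC Λ₀ h * (blockB Λ₀ h)⁻¹ * rowsOut Λ₀ V * diagonal γ
        - blockC Λ₀ h * rowsOut Λ₀ V := by
    rw [blockCBC, Matrix.mul_assoc _ _ (rowsIn Λ₀ V), eq_sub_of_add_eq h2, Matrix.mul_sub,
      ← Matrix.mul_assoc _ (blockB Λ₀ h), Matrix.mul_assoc _ _ (blockB Λ₀ h), hB, Matrix.mul_one,
      ← Matrix.mul_assoc _ (rowsOut Λ₀ V)]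
  rw [schurComplement, nuMatrix, Matrix.sub_mul, Matrix.sub_mul, h3, ← h1]
  abel

lemma schurComplement_eq :
    schurComplement Λ₀ h = nuMatrix Λ₀ h V * diagonal γ * (nuMatrix Λ₀ h V)ᵀ := by
  rw [← schurComplement_mul_rowsIn Λ₀ hV hγ hdiag, Matrix.mul_assoc,
    rowsIn_mul_nuMatrix_transpose Λ₀ hV, Matrix.mul_one]

lemma schurComplement_posDef : (schurComplement Λ₀ h).PosDef := by
  rw [schurComplement_eq Λ₀ hV hγ hdiag]
  exact posDef_mul_diagonal_mul_transpose hγ (nuMatrix_mul_rowsIn_transpose Λ₀ hV)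

/-- The block form of `Vᵀ h^{-1/2} V = diag(γ)⁻¹`. -/
lemma nuMatrix_schurComplement_inv_add :
    ((nuMatrix Λ₀ h V)ᵀ * (schurComplement Λ₀ h)⁻¹ * nuMatrix Λ₀ h V
      + (rowsOut Λ₀ V)ᵀ * (blockB Λ₀ h)⁻¹ * rowsOut Λ₀ V) * diagonal γ = 1 := by
  have hT := Matrix.nonsing_inv_mul _ ((Matrix.isUnit_iff_isUnit_det _).1
    (schurComplement_posDef Λ₀ hV hγ hdiag).isUnit)
  have hB := Matrix.nonsing_inv_mul _ (blockB_isUnit_det Λ₀ hV hγ hdiag)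
  rw [Matrix.add_mul, Matrix.mul_assoc _ (nuMatrix Λ₀ h V), Matrix.mul_assoc _ (rowsOut Λ₀ V),
    ← schurComplement_mul_rowsIn Λ₀ hV hγ hdiag, ← blockC_transpose_mul_rowsIn Λ₀ hV hγ hdiag,
    ← Matrix.mul_assoc _ (schurComplement Λ₀ h), Matrix.mul_assoc _ _ (schurComplement Λ₀ h), hT,
    Matrix.mul_one, Matrix.mul_add, ← Matrix.mul_assoc _ (blockB Λ₀ h),
    Matrix.mul_assoc _ _ (blockB Λ₀ h), hB, Matrix.mul_one, ← rows_transpose_mul_add Λ₀ hV,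
    nuMatrix, Matrix.transpose_sub, Matrix.transpose_mul, Matrix.transpose_mul,
    blockB_inv_transpose Λ₀ hV hγ hdiag, Matrix.sub_mul]
  simp only [Matrix.mul_assoc]
  abel

lemma det_blockB_mul_det_schurComplement :
    (blockB Λ₀ h).det * (schurComplement Λ₀ h).det = ∏ k, γ k := by
  have hdet : (matPow h (1 / 2)).det = ∏ k, γ k := by
    rw [matPow_half_eq hV hγ hdiag, det_orthogonal_diagonal hV]
  have hsym : (matPow h (1 / 2))ᵀ = matPow h (1 / 2) := by
    rw [matPow_half_eq hV hγ hdiag, transpose_orthogonal_diagonal]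
  have : Invertible (blockB Λ₀ h) :=
    Matrix.invertibleOfIsUnitDet _ (blockB_isUnit_det Λ₀ hV hγ hdiag)
  have hC : toBlock (matPow h (1 / 2)) (fun i => ¬ i ∈ Λ₀) (fun i => i ∈ Λ₀)
      = (blockC Λ₀ h)ᵀ := by
    ext i j
    exact congrFun (congrFun hsym j.1) i.1
  rw [← hdet, Matrix.det_toBlock _ (fun i => i ∈ Λ₀), hC, schurComplement, blockCBC,
    ← Matrix.invOf_eq_nonsing_inv]
  convert (Matrix.det_fromBlocks₂₂ (blockA Λ₀ h) (blockC Λ₀ h) (blockC Λ₀ h)ᵀ (blockB Λ₀ h)).symm <;> rfl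

end

end Blocks

/-! ### Simultaneous diagonalization -/

section Diagonalization

variable {ι : Type*} [Fintype ι] [DecidableEq ι]

lemma transpose_mul_of_eq_orthogonal_diagonal {U M : Matrix ι ι ℝ} (hU : U ∈ orthogonalGroup ι ℝ)
    {d : ι → ℝ} (h : M = U * diagonal d * Uᵀ) : Uᵀ * M * U = diagonal d := by
  rw [h]
  calc _ = (Uᵀ * U) * diagonal d * (Uᵀ * U) := by simp only [Matrix.mul_assoc]
    _ = _ := by rw [orthogonal_transpose_mul hU, Matrix.one_mul, Matrix.mul_one]

lemma posDef_transpose_mul_mul_same {M R : Matrix ι ι ℝ} (hM : M.PosDef) (hR : R.det ≠ 0) :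
    (Rᵀ * M * R).PosDef := by
  have := hM.conjTranspose_mul_mul_same (B := R)
    (Matrix.mulVec_injective_iff_isUnit.2 ((Matrix.isUnit_iff_isUnit_det R).2 hR.isUnit))
  simpa [conjTranspose_eq_transpose_of_trivial] using this

lemma orthogonal_det_ne_zero {U : Matrix ι ι ℝ} (hU : U ∈ orthogonalGroup ι ℝ) : U.det ≠ 0 := by
  intro h0
  have := congrArg det (orthogonal_transpose_mul hU)
  simp [det_mul, h0] at this

omit [Fintype ι] [DecidableEq ι] in
lemma mu_sq {σ : ι → ℝ} (hσ : ∀ j, -1 < σ j ∧ σ j ≤ 0) (j : ι) :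
    mu σ j ^ 2 = (1 - σ j) / (1 + σ j) :=
  Real.sq_sqrt (div_nonneg (by linarith [(hσ j).2]) (by linarith [(hσ j).1]))

omit [Fintype ι] [DecidableEq ι] in
lemma one_le_mu {σ : ι → ℝ} (hσ : ∀ j, -1 < σ j ∧ σ j ≤ 0) (j : ι) : 1 ≤ mu σ j := by
  rw [mu, Real.one_le_sqrt, one_le_div (by linarith [(hσ j).1])]
  linarith [(hσ j).2]

/-- Let `Θ = A^{-1/2} K A^{-1/2}` with `A - K` positive definite and `K` positive semidefinite, and
let `Y = (1 - Θ/2)^{-1/2}`. A matrix `F₂` that diagonalizes `-YΘY/2`, with eigenvalues `σ`, also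
diagonalizes `Y² = 1 + YΘY/2`, hence `Θ`; so `F₂ᵀ A^{-1/2}` diagonalizes the forms `A` and `A - K`
simultaneously. -/
lemma simultaneous_diagonalization {A K F₂ : Matrix ι ι ℝ} {σ : ι → ℝ} (hA : A.PosDef)
    (hK : K.PosSemidef) (hT : (A - K).PosDef) (hF₂ : F₂ ∈ orthogonalGroup ι ℝ)
    {Z Θ F₁ : Matrix ι ι ℝ} (hZ : Z = matPow A (-(1 / 2))) (hΘ : Θ = Z * K * Z)
    (hF₁ : F₁ = Z * matPow (1 - (1 / 2 : ℝ) • Θ) (-(1 / 2)))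
    (hσ : (-(1 / 2) : ℝ) • (F₁ᵀ * K * F₁) = F₂ * diagonal σ * F₂ᵀ) :
    (∀ j, -1 < σ j ∧ σ j ≤ 0) ∧
    matPow (1 - Θ) (-(1 / 2)) = F₂ * diagonal (mu σ) * F₂ᵀ ∧
    F₁ * F₂ = (F₂ᵀ * Z)ᵀ * diagonal (fun j => √(1 - σ j)) ∧
    F₂ᵀ * Z * A * (F₂ᵀ * Z)ᵀ = 1 ∧
    F₂ᵀ * Z * (A - K) * (F₂ᵀ * Z)ᵀ = diagonal (fun j => (mu σ j ^ 2)⁻¹) := by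
  obtain ⟨hZt, hZA, hZdet⟩ := matPow_neg_half_spec hA
  rw [← hZ] at hZt hZA hZdet
  have hP : 1 - Θ = Z * (A - K) * Z := by rw [Matrix.mul_sub, Matrix.sub_mul, hZA, hΘ]
  have hPpos : (1 - Θ).PosDef := by
    have := posDef_transpose_mul_mul_same hT hZdet.ne'
    rwa [hZt, ← hP] at this
  have hM : 1 - (1 / 2 : ℝ) • Θ = (1 / 2 : ℝ) • (1 : Matrix ι ι ℝ) + (1 / 2 : ℝ) • (1 - Θ) := by
    rw [smul_sub, add_sub, ← add_smul]
    norm_num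
  have hMpos : (1 - (1 / 2 : ℝ) • Θ).PosDef := by
    rw [hM]
    exact (Matrix.PosDef.one.smul (by norm_num)).add (hPpos.smul (by norm_num))
  obtain ⟨hYt, hYM, hYdet⟩ := matPow_neg_half_spec hMpos
  set Y := matPow (1 - (1 / 2 : ℝ) • Θ) (-(1 / 2)) with hY
  have hX : (-(1 / 2) : ℝ) • (Y * Θ * Y) = F₂ * diagonal σ * F₂ᵀ := by
    rw [← hσ, hF₁, hΘ, Matrix.transpose_mul, hYt, hZt]
    simp only [Matrix.mul_assoc]
  have h1 : Y * Y - (1 / 2 : ℝ) • (Y * Θ * Y) = 1 := by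
    rw [← hYM, Matrix.mul_sub, Matrix.sub_mul, Matrix.mul_one, Matrix.mul_smul, Matrix.smul_mul]
  have hadd : ∀ a b : ι → ℝ, F₂ * diagonal a * F₂ᵀ + F₂ * diagonal b * F₂ᵀ
      = F₂ * diagonal (fun j => a j + b j) * F₂ᵀ := fun a b => by
    rw [← Matrix.add_mul, ← Matrix.mul_add, diagonal_add]
  have hsmul : ∀ (c : ℝ) (a : ι → ℝ), c • (F₂ * diagonal a * F₂ᵀ)
      = F₂ * diagonal (fun j => c * a j) * F₂ᵀ := fun c a => by
    rw [← Matrix.smul_mul, ← Matrix.mul_smul, ← diagonal_smul]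
    rfl
  have hone := orthogonal_diagonal_const hF₂
  have hσpos : ∀ j, -1 < σ j := by
    have hYP : Y * (1 - Θ) * Y = F₂ * diagonal (fun j => 1 + σ j) * F₂ᵀ := by
      rw [← hadd, hone, ← hX, Matrix.mul_sub, Matrix.sub_mul, Matrix.mul_one]
      rw [← h1, sub_add, sub_right_inj, ← sub_smul]
      norm_num
    have hpos := posDef_transpose_mul_mul_same
      (posDef_transpose_mul_mul_same hPpos hYdet.ne') (orthogonal_det_ne_zero hF₂)
    rw [hYt, transpose_mul_of_eq_orthogonal_diagonal hF₂ hYP] at hpos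
    intro j
    have := hpos.diag_pos (i := j)
    rw [diagonal_apply_eq] at this
    linarith
  have hσneg : ∀ j, σ j ≤ 0 := by
    have hpos := hK.conjTranspose_mul_mul_same (F₁ * F₂)
    rw [conjTranspose_eq_transpose_of_trivial] at hpos
    have heq : (F₁ * F₂)ᵀ * K * (F₁ * F₂) = diagonal (fun j => -2 * σ j) := by
      rw [← transpose_mul_of_eq_orthogonal_diagonal hF₂ (hsmul (-2) σ), ← hσ, smul_smul,
        Matrix.transpose_mul]
      norm_num
      simp only [Matrix.mul_assoc]
    rw [heq] at hpos
    intro j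
    have := hpos.diag_nonneg (i := j)
    rw [diagonal_apply_eq] at this
    linarith
  have hσ' : ∀ j, 1 - σ j ≠ 0 := fun j => by linarith [hσneg j]
  have hYY : Y * Y = F₂ * diagonal (fun j => 1 - σ j) * F₂ᵀ := by
    have : (fun j => 1 - σ j) = fun j => 1 + (-1) * σ j := by ext j; ring
    rw [this, ← hadd, hone, ← hsmul, ← hX, smul_smul, ← h1]
    norm_num
  have hMdiag : 1 - (1 / 2 : ℝ) • Θ = F₂ * diagonal (fun j => (1 - σ j)⁻¹) * F₂ᵀ := by
    have hMYY : (1 - (1 / 2 : ℝ) • Θ) * (Y * Y) = 1 := by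
      rw [← Matrix.mul_assoc, mul_eq_one_comm, ← Matrix.mul_assoc, hYM]
    have hinv : (Y * Y) * (F₂ * diagonal (fun j => (1 - σ j)⁻¹) * F₂ᵀ) = 1 := by
      rw [hYY, orthogonal_diagonal_mul hF₂, ← hone]
      congr 3
      ext j
      exact mul_inv_cancel₀ (hσ' j)
    calc _ = (1 - (1 / 2 : ℝ) • Θ) * ((Y * Y) * (F₂ * diagonal (fun j => (1 - σ j)⁻¹) * F₂ᵀ)) := by
          rw [hinv, Matrix.mul_one]
      _ = _ := by rw [← Matrix.mul_assoc, hMYY, Matrix.one_mul]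
  have hPdiag : 1 - Θ = F₂ * diagonal (fun j => (1 + σ j) / (1 - σ j)) * F₂ᵀ := by
    have : (fun j => (1 + σ j) / (1 - σ j)) = fun j => -1 * 1 + 2 * (1 - σ j)⁻¹ := by
      ext j
      have := hσ' j
      field_simp
      ring
    rw [this, ← hadd, ← hsmul, ← hsmul, ← hMdiag, hone, smul_sub, smul_smul, sub_eq_add_neg,
      sub_eq_add_neg, ← add_assoc, ← add_smul]
    norm_num
  have hσ2 : ∀ j, -1 < σ j ∧ σ j ≤ 0 := fun j => ⟨hσpos j, hσneg j⟩
  refine ⟨hσ2, ?_, ?_, ?_, ?_⟩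
  · rw [hPdiag, matPow_orthogonal_diagonal hF₂]
    congr 3
    ext j
    have := hσ2 j
    rw [mu, Real.sqrt_eq_rpow, ← inv_div, Real.inv_rpow (div_nonneg (by linarith) (by linarith)),
      Real.rpow_neg (div_nonneg (by linarith) (by linarith)), inv_inv]
  · have hYdiag : Y = F₂ * diagonal (fun j => √(1 - σ j)) * F₂ᵀ := by
      rw [hY, hMdiag, matPow_orthogonal_diagonal hF₂]
      congr 3
      ext j
      rw [Real.sqrt_eq_rpow, Real.inv_rpow (by linarith [hσneg j]),
        Real.rpow_neg (by linarith [hσneg j]), inv_inv]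
    rw [hF₁, hYdiag, Matrix.transpose_mul, Matrix.transpose_transpose, hZt]
    simp only [Matrix.mul_assoc]
    rw [orthogonal_transpose_mul hF₂, Matrix.mul_one]
  · rw [Matrix.transpose_mul, Matrix.transpose_transpose, hZt]
    calc _ = F₂ᵀ * (Z * A * Z) * F₂ := by simp only [Matrix.mul_assoc]
      _ = _ := by rw [hZA, Matrix.mul_one, orthogonal_transpose_mul hF₂]
  · rw [Matrix.transpose_mul, Matrix.transpose_transpose, hZt]
    calc _ = F₂ᵀ * (Z * (A - K) * Z) * F₂ := by simp only [Matrix.mul_assoc]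
      _ = _ := by
        rw [← hP, transpose_mul_of_eq_orthogonal_diagonal hF₂ hPdiag]
        congr 1
        ext j
        rw [mu_sq hσ2, inv_div]

variable {A K G F : Matrix ι ι ℝ} {σ : ι → ℝ}

lemma form_diagonal (hσ : ∀ j, -1 < σ j ∧ σ j ≤ 0)
    (hF : F = Gᵀ * diagonal (fun j => √(1 - σ j))) (hGA : G * A * Gᵀ = 1) :
    Fᵀ * A * F = diagonal (fun j => 1 - σ j) := by
  rw [hF, Matrix.transpose_mul, Matrix.transpose_transpose, diagonal_transpose]
  calc _ = diagonal (fun j => √(1 - σ j)) * (G * A * Gᵀ) * diagonal (fun j => √(1 - σ j)) := by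
        simp only [Matrix.mul_assoc]
    _ = _ := by
      rw [hGA, Matrix.mul_one, diagonal_mul_diagonal]
      congr 1
      ext j
      exact Real.mul_self_sqrt (by linarith [(hσ j).2])

lemma form_schur_diagonal (hσ : ∀ j, -1 < σ j ∧ σ j ≤ 0)
    (hF : F = Gᵀ * diagonal (fun j => √(1 - σ j)))
    (hGT : G * (A - K) * Gᵀ = diagonal (fun j => (mu σ j ^ 2)⁻¹)) :
    Fᵀ * (A - K) * F = diagonal (fun j => 1 + σ j) := by
  rw [hF, Matrix.transpose_mul, Matrix.transpose_transpose, diagonal_transpose]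
  calc _ = diagonal (fun j => √(1 - σ j)) * (G * (A - K) * Gᵀ)
          * diagonal (fun j => √(1 - σ j)) := by simp only [Matrix.mul_assoc]
    _ = _ := by
      rw [hGT, diagonal_mul_diagonal, diagonal_mul_diagonal]
      congr 1
      ext j
      have h2 : 1 - σ j ≠ 0 := by linarith [(hσ j).2]
      rw [mul_right_comm, Real.mul_self_sqrt (by linarith [(hσ j).2]), mu_sq hσ]
      field_simp

/-- If `G T Gᵀ` is diagonal, then so is `T⁻¹` in the same coordinates. -/
lemma inv_eq_of_mul_mul_transpose {T : Matrix ι ι ℝ} {d : ι → ℝ} (hd : ∀ j, d j ≠ 0)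
    (h : G * T * Gᵀ = diagonal (fun j => (d j)⁻¹)) : T⁻¹ = Gᵀ * diagonal d * G := by
  refine Matrix.inv_eq_right_inv ?_
  have h1 : G * (T * Gᵀ * diagonal d) = 1 := by
    rw [← Matrix.mul_assoc, ← Matrix.mul_assoc, h, diagonal_mul_diagonal, ← diagonal_one]
    congr 1
    ext j
    exact inv_mul_cancel₀ (hd j)
  rw [← Matrix.mul_assoc, ← Matrix.mul_assoc, mul_eq_one_comm]
  exact h1

end Diagonalization

/-! ### The weights -/

section Weights

variable {Λ : Type*} [Fintype Λ] [DecidableEq Λ] (Λ₀ : Finset Λ)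
  {h V : Matrix Λ Λ ℝ} {γ : Λ → ℝ} (hV : V ∈ orthogonalGroup Λ ℝ) (hγ : ∀ k, 0 < γ k)
  (hdiag : h = V * diagonal (fun k => γ k ^ 2) * Vᵀ)

lemma mul_diagonal_mul_transpose_apply_self {κ : Type*} [Fintype κ] [DecidableEq κ]
    (M : Matrix κ Λ ℝ) (d : Λ → ℝ) (j : κ) :
    (M * diagonal d * Mᵀ) j j = ∑ k, d k * M j k ^ 2 := by
  rw [Matrix.mul_apply]
  refine Finset.sum_congr rfl fun k _ => ?_
  rw [Matrix.mul_diagonal, Matrix.transpose_apply]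
  ring

lemma weightQ_eq (F₂ : Matrix {i // i ∈ Λ₀} {i // i ∈ Λ₀} ℝ) (σ : {i // i ∈ Λ₀} → ℝ) (k : Λ)
    (j : {i // i ∈ Λ₀}) :
    weightQ Λ₀ h V γ F₂ σ k j = γ k
      * (mu σ j ^ 2 * (F₂ᵀ * matPow (blockA Λ₀ h) (-(1 / 2)) * nuMatrix Λ₀ h V) j k ^ 2
        + (F₂ᵀ * matPow (blockA Λ₀ h) (-(1 / 2)) * rowsIn Λ₀ V) j k ^ 2) := by
  rw [weightQ, sq_abs, sq_abs]
  rfl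

variable {G : Matrix {i // i ∈ Λ₀} {i // i ∈ Λ₀} ℝ} {μ : {i // i ∈ Λ₀} → ℝ} (hμ : ∀ j, 1 ≤ μ j)
  (hGA : G * blockA Λ₀ h * Gᵀ = 1)
  (hGT : G * schurComplement Λ₀ h * Gᵀ = diagonal (fun j => (μ j ^ 2)⁻¹))

include hV hγ hdiag

include hμ hGT in
/-- The diagonal entry of `nuMatrix_schurComplement_inv_add`. -/
lemma sum_mu_sq_nuMatrix_add (k : Λ) :
    γ k * (∑ j, μ j ^ 2 * (G * nuMatrix Λ₀ h V) j k ^ 2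
      + ((rowsOut Λ₀ V)ᵀ * (blockB Λ₀ h)⁻¹ * rowsOut Λ₀ V) k k) = 1 := by
  have h1 := congrFun (congrFun (nuMatrix_schurComplement_inv_add Λ₀ hV hγ hdiag) k) k
  have hT := inv_eq_of_mul_mul_transpose
    (fun j => pow_ne_zero 2 (zero_lt_one.trans_le (hμ j)).ne') hGT
  rw [Matrix.mul_diagonal, Matrix.one_apply_eq, Matrix.add_apply, hT] at h1
  have h2 : (nuMatrix Λ₀ h V)ᵀ * (Gᵀ * diagonal (fun j => μ j ^ 2) * G) * nuMatrix Λ₀ h V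
      = (G * nuMatrix Λ₀ h V)ᵀ * diagonal (fun j => μ j ^ 2) * ((G * nuMatrix Λ₀ h V)ᵀ)ᵀ := by
    rw [Matrix.transpose_transpose, Matrix.transpose_mul]
    simp only [Matrix.mul_assoc]
  rw [h2, mul_diagonal_mul_transpose_apply_self] at h1
  rw [mul_comm]
  exact h1

lemma rowsOut_blockB_inv_nonneg (k : Λ) :
    0 ≤ ((rowsOut Λ₀ V)ᵀ * (blockB Λ₀ h)⁻¹ * rowsOut Λ₀ V) k k := by
  have := (blockB_posDef Λ₀ hV hγ hdiag).inv.posSemidef.conjTranspose_mul_mul_same (rowsOut Λ₀ V)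
  rw [conjTranspose_eq_transpose_of_trivial] at this
  exact this.diag_nonneg

include hGA in
/-- The matrix `M = Vinᵀ A⁻¹ Vin` satisfies `M diag(γ) M = M`, so `γ_k M_{kk} ≤ 1`. -/
lemma sum_rowsIn_le (k : Λ) : γ k * ∑ j, (G * rowsIn Λ₀ V) j k ^ 2 ≤ 1 := by
  set M := (G * rowsIn Λ₀ V)ᵀ * (G * rowsIn Λ₀ V) with hM
  have hMk : M k k = ∑ j, (G * rowsIn Λ₀ V) j k ^ 2 := by
    rw [hM, Matrix.mul_apply]
    exact Finset.sum_congr rfl fun j _ => (sq _).symm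
  have hMt : Mᵀ = M := by rw [hM, Matrix.transpose_mul, Matrix.transpose_transpose]
  have hproj : M * diagonal γ * Mᵀ = M := by
    rw [hMt, hM]
    calc _ = (G * rowsIn Λ₀ V)ᵀ * (G * (rowsIn Λ₀ V * diagonal γ * (rowsIn Λ₀ V)ᵀ) * Gᵀ)
          * (G * rowsIn Λ₀ V) := by
          simp only [Matrix.transpose_mul, Matrix.mul_assoc]
      _ = _ := by rw [← blockA_eq Λ₀ hV hγ hdiag, hGA, Matrix.mul_one]
  have h1 := congrFun (congrFun hproj k) k
  rw [mul_diagonal_mul_transpose_apply_self] at h1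
  have h2 : γ k * M k k ^ 2 ≤ M k k := by
    rw [← h1]
    nth_rewrite 1 [h1]
    exact Finset.single_le_sum (f := fun i => γ i * M k i ^ 2)
      (fun i _ => mul_nonneg (hγ i).le (sq_nonneg _)) (Finset.mem_univ k)
  rw [← hMk]
  have h3 : 0 ≤ M k k := hMk ▸ Finset.sum_nonneg fun j _ => sq_nonneg _
  by_contra hcon
  push Not at hcon
  have h4 : 0 < M k k := lt_of_le_of_ne h3 fun h0 => by rw [← h0] at hcon; norm_num at hcon
  nlinarith [mul_lt_mul_of_pos_right hcon h4]

include hGA in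
lemma sum_gamma_rowsIn (j : {i // i ∈ Λ₀}) : ∑ k, γ k * (G * rowsIn Λ₀ V) j k ^ 2 = 1 := by
  rw [← mul_diagonal_mul_transpose_apply_self, Matrix.transpose_mul]
  have : G * rowsIn Λ₀ V * diagonal γ * ((rowsIn Λ₀ V)ᵀ * Gᵀ) = 1 := by
    rw [← hGA, blockA_eq Λ₀ hV hγ hdiag]
    simp only [Matrix.mul_assoc]
  rw [this, Matrix.one_apply_eq]

include hGT in
lemma sum_gamma_nuMatrix (j : {i // i ∈ Λ₀}) :
    ∑ k, γ k * (G * nuMatrix Λ₀ h V) j k ^ 2 = (μ j ^ 2)⁻¹ := by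
  rw [← mul_diagonal_mul_transpose_apply_self, Matrix.transpose_mul]
  have : G * nuMatrix Λ₀ h V * diagonal γ * ((nuMatrix Λ₀ h V)ᵀ * Gᵀ)
      = diagonal (fun j => (μ j ^ 2)⁻¹) := by
    rw [← hGT, schurComplement_eq Λ₀ hV hγ hdiag]
    simp only [Matrix.mul_assoc]
  rw [this, diagonal_apply_eq]

end Weights

/-! ### The reduced kernels -/

section ReducedKernel

lemma hermiteGauss_zero (γ y : ℝ) :
    hermiteGauss γ 0 y = (γ / Real.pi) ^ (1 / 4 : ℝ) * Real.exp (-(1 / 2) * γ * y ^ 2) := by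
  simp [hermiteGauss, hermiteH_eq_eval, hermitePoly]

lemma hermiteGauss_one (γ y : ℝ) :
    hermiteGauss γ 1 y = √(2 * γ) * y * hermiteGauss γ 0 y := by
  have h2 : √(2 : ℝ) * √2 = 2 := Real.mul_self_sqrt (by norm_num)
  have h0 : √(2 : ℝ) ≠ 0 := by positivity
  have hH : hermiteH 1 (√γ * y) = 2 * (√γ * y) := by simp [hermiteH_eq_eval, hermitePoly]
  rw [hermiteGauss_zero, hermiteGauss, hH, Real.sqrt_mul zero_le_two γ]
  simp only [pow_one, Nat.factorial_one, Nat.cast_one, mul_one]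
  field_simp
  linear_combination (-((γ / Real.pi) ^ (1 / 4 : ℝ) * y * √γ)) * h2

section

variable {Λ : Type*} [Fintype Λ] [DecidableEq Λ]

/-- The normalization `∏_k (γ_k/π)^{1/4}` of the ground state of the full system. -/
def groundNorm (γ : Λ → ℝ) : ℝ := ∏ k, (γ k / Real.pi) ^ (1 / 4 : ℝ)

omit [DecidableEq Λ] in
lemma groundNorm_sq {γ : Λ → ℝ} (hγ : ∀ k, 0 < γ k) :
    groundNorm γ ^ 2 = ∏ k, √(γ k / Real.pi) := by
  rw [groundNorm, sq, ← Finset.prod_mul_distrib]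
  exact Finset.prod_congr rfl fun k _ => rpow_quarter_mul_self (div_pos (hγ k) Real.pi_pos).le

omit [DecidableEq Λ] in
lemma eigenfunction_zero (V : Matrix Λ Λ ℝ) (γ : Λ → ℝ) (z : Λ → ℝ) :
    eigenfunction V γ 0 z
      = groundNorm γ * Real.exp (-(1 / 2) * ∑ k, γ k * (Vᵀ *ᵥ z) k ^ 2) := by
  rw [eigenfunction, hermiteProd, groundNorm, Finset.mul_sum, Real.exp_sum,
    ← Finset.prod_mul_distrib]
  refine Finset.prod_congr rfl fun k _ => ?_
  rw [Pi.zero_apply, hermiteGauss_zero, mul_assoc (-(1 / 2) : ℝ)]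

lemma eigenfunction_single (V : Matrix Λ Λ ℝ) (γ : Λ → ℝ) (k : Λ) (z : Λ → ℝ) :
    eigenfunction V γ (Pi.single k 1) z
      = √(2 * γ k) * (Vᵀ *ᵥ z) k * eigenfunction V γ 0 z := by
  rw [eigenfunction, eigenfunction, hermiteProd, hermiteProd,
    ← Finset.mul_prod_erase _ _ (Finset.mem_univ k), Pi.single_eq_same, hermiteGauss_one,
    ← Finset.mul_prod_erase Finset.univ (fun j => hermiteGauss (γ j) ((0 : Λ → ℕ) j) _)
      (Finset.mem_univ k), mul_assoc]
  congr 2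
  refine Finset.prod_congr rfl fun j hj => ?_
  rw [Pi.single_eq_of_ne (Finset.ne_of_mem_erase hj), Pi.zero_apply]

variable (Λ₀ : Finset Λ)

lemma transpose_mulVec_glue (V : Matrix Λ Λ ℝ) (x : {i // i ∈ Λ₀} → ℝ) (u : {i // i ∉ Λ₀} → ℝ)
    (k : Λ) :
    (Vᵀ *ᵥ glue Λ₀ x u) k = eigvecIn Λ₀ V k ⬝ᵥ x + eigvecOut Λ₀ V k ⬝ᵥ u := by
  have h1 : ∑ i : {i // i ∈ Λ₀}, V i k * glue Λ₀ x u i = eigvecIn Λ₀ V k ⬝ᵥ x :=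
    Finset.sum_congr rfl fun i _ => by rw [glue, dif_pos i.2]; rfl
  have h2 : ∑ i : {i // i ∉ Λ₀}, V i k * glue Λ₀ x u i = eigvecOut Λ₀ V k ⬝ᵥ u :=
    Finset.sum_congr rfl fun i _ => by rw [glue, dif_neg i.2]; rfl
  rw [← h1, ← h2]
  symm
  convert Fintype.sum_subtype_add_sum_subtype (fun i => i ∈ Λ₀) fun i => V i k * glue Λ₀ x u i
  rfl

lemma dotProduct_mul_diagonal_mul_transpose_mulVec {κ κ' : Type*} [Fintype κ]
    [Fintype κ'] (X : Matrix κ Λ ℝ) (Y : Matrix κ' Λ ℝ) (d : Λ → ℝ) (x : κ → ℝ) (y : κ' → ℝ) :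
    x ⬝ᵥ (X * diagonal d * Yᵀ) *ᵥ y = ∑ k, d k * (Xᵀ *ᵥ x) k * (Yᵀ *ᵥ y) k := by
  rw [← Matrix.mulVec_mulVec, ← Matrix.mulVec_mulVec, Matrix.dotProduct_mulVec,
    ← Matrix.mulVec_transpose]
  refine Finset.sum_congr rfl fun k _ => ?_
  rw [Matrix.mulVec_diagonal]
  ring

variable {h V : Matrix Λ Λ ℝ} {γ : Λ → ℝ} (hV : V ∈ orthogonalGroup Λ ℝ) (hγ : ∀ k, 0 < γ k)
  (hdiag : h = V * diagonal (fun k => γ k ^ 2) * Vᵀ)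

include hV hγ hdiag

lemma sum_gamma_sq_glue (x : {i // i ∈ Λ₀} → ℝ) (u : {i // i ∉ Λ₀} → ℝ) :
    ∑ k, γ k * (Vᵀ *ᵥ glue Λ₀ x u) k ^ 2
      = x ⬝ᵥ blockA Λ₀ h *ᵥ x + 2 * (((blockC Λ₀ h)ᵀ *ᵥ x) ⬝ᵥ u) + u ⬝ᵥ blockB Λ₀ h *ᵥ u := by
  have hC : ((blockC Λ₀ h)ᵀ *ᵥ x) ⬝ᵥ u = x ⬝ᵥ blockC Λ₀ h *ᵥ u := by
    rw [Matrix.mulVec_transpose, Matrix.dotProduct_mulVec]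
  rw [hC, blockA_eq Λ₀ hV hγ hdiag, blockB_eq Λ₀ hV hγ hdiag, blockC_eq Λ₀ hV hγ hdiag,
    dotProduct_mul_diagonal_mul_transpose_mulVec, dotProduct_mul_diagonal_mul_transpose_mulVec,
    dotProduct_mul_diagonal_mul_transpose_mulVec, Finset.mul_sum, ← Finset.sum_add_distrib,
    ← Finset.sum_add_distrib]
  refine Finset.sum_congr rfl fun k _ => ?_
  have h1 : ((rowsIn Λ₀ V)ᵀ *ᵥ x) k = eigvecIn Λ₀ V k ⬝ᵥ x := rfl
  have h2 : ((rowsOut Λ₀ V)ᵀ *ᵥ u) k = eigvecOut Λ₀ V k ⬝ᵥ u := rfl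
  rw [transpose_mulVec_glue, h1, h2]
  ring

/-- The dependence on `u` is a Gaussian with quadratic form `B` and linear term `Cᵀ(x+y)`. -/
lemma stateKernel_zero_glue (x y : {i // i ∈ Λ₀} → ℝ) (u : {i // i ∉ Λ₀} → ℝ) :
    stateKernel V γ 0 (glue Λ₀ x u) (glue Λ₀ y u)
      = groundNorm γ ^ 2
          * Real.exp (-(1 / 2) * (x ⬝ᵥ blockA Λ₀ h *ᵥ x + y ⬝ᵥ blockA Λ₀ h *ᵥ y))
        * Real.exp (-(((blockC Λ₀ h)ᵀ *ᵥ (x + y)) ⬝ᵥ u) - u ⬝ᵥ blockB Λ₀ h *ᵥ u) := by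
  rw [stateKernel, eigenfunction_zero, eigenfunction_zero, sum_gamma_sq_glue Λ₀ hV hγ hdiag,
    sum_gamma_sq_glue Λ₀ hV hγ hdiag, mul_mul_mul_comm, ← Real.exp_add, ← sq, mul_assoc,
    ← Real.exp_add, Matrix.mulVec_add, add_dotProduct]
  congr 2
  ring

lemma stateKernel_single_glue (k : Λ) (x y : {i // i ∈ Λ₀} → ℝ) (u : {i // i ∉ Λ₀} → ℝ) :
    stateKernel V γ (Pi.single k 1) (glue Λ₀ x u) (glue Λ₀ y u)
      = 2 * γ k * (groundNorm γ ^ 2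
          * Real.exp (-(1 / 2) * (x ⬝ᵥ blockA Λ₀ h *ᵥ x + y ⬝ᵥ blockA Λ₀ h *ᵥ y)))
        * ((eigvecIn Λ₀ V k ⬝ᵥ x + eigvecOut Λ₀ V k ⬝ᵥ u)
          * (eigvecIn Λ₀ V k ⬝ᵥ y + eigvecOut Λ₀ V k ⬝ᵥ u)
          * Real.exp (-(((blockC Λ₀ h)ᵀ *ᵥ (x + y)) ⬝ᵥ u) - u ⬝ᵥ blockB Λ₀ h *ᵥ u)) := by
  have h0 := stateKernel_zero_glue Λ₀ hV hγ hdiag x y u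
  have hs : √(2 * γ k) * √(2 * γ k) = 2 * γ k :=
    Real.mul_self_sqrt (mul_nonneg zero_le_two (hγ k).le)
  rw [stateKernel] at h0
  rw [stateKernel, eigenfunction_single, eigenfunction_single, transpose_mulVec_glue,
    transpose_mulVec_glue]
  linear_combination (2 * γ k * (eigvecIn Λ₀ V k ⬝ᵥ x + eigvecOut Λ₀ V k ⬝ᵥ u)
      * (eigvecIn Λ₀ V k ⬝ᵥ y + eigvecOut Λ₀ V k ⬝ᵥ u)) * h0
    + (eigvecIn Λ₀ V k ⬝ᵥ x + eigvecOut Λ₀ V k ⬝ᵥ u)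
      * (eigvecIn Λ₀ V k ⬝ᵥ y + eigvecOut Λ₀ V k ⬝ᵥ u)
      * eigenfunction V γ 0 (glue Λ₀ x u) * eigenfunction V γ 0 (glue Λ₀ y u) * hs

lemma integrable_stateKernel_zero (x y : {i // i ∈ Λ₀} → ℝ) :
    Integrable (fun u : {i // i ∉ Λ₀} → ℝ =>
      stateKernel V γ 0 (glue Λ₀ x u) (glue Λ₀ y u)) := by
  simp_rw [stateKernel_zero_glue Λ₀ hV hγ hdiag]
  have := (integral_gaussian_quadratic_linear (blockB_posDef Λ₀ hV hγ hdiag) 0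
    ((blockC Λ₀ h)ᵀ *ᵥ (x + y)) 1 1).1
  simp only [zero_dotProduct, add_zero, one_mul] at this
  exact this.const_mul _

lemma integrable_stateKernel_single (k : Λ) (x y : {i // i ∈ Λ₀} → ℝ) :
    Integrable (fun u : {i // i ∉ Λ₀} → ℝ =>
      stateKernel V γ (Pi.single k 1) (glue Λ₀ x u) (glue Λ₀ y u)) := by
  simp_rw [stateKernel_single_glue Λ₀ hV hγ hdiag]
  exact (integral_gaussian_quadratic_linear (blockB_posDef Λ₀ hV hγ hdiag) _ _ _ _).1.const_mul _

omit hV hγ hdiag in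
lemma dotProduct_blockCBC (z : {i // i ∈ Λ₀} → ℝ) :
    ((blockC Λ₀ h)ᵀ *ᵥ z) ⬝ᵥ (blockB Λ₀ h)⁻¹ *ᵥ ((blockC Λ₀ h)ᵀ *ᵥ z)
      = z ⬝ᵥ blockCBC Λ₀ h *ᵥ z := by
  rw [blockCBC, ← Matrix.mulVec_mulVec, ← Matrix.mulVec_mulVec, Matrix.dotProduct_mulVec z,
    Matrix.mulVec_transpose]

lemma reducedKernel_zero (x y : {i // i ∈ Λ₀} → ℝ) :
    reducedKernel Λ₀ (stateKernel V γ 0) x y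
      = groundNorm γ ^ 2 * gaussianMass (blockB Λ₀ h)
        * Real.exp (-(1 / 2) * (x ⬝ᵥ blockA Λ₀ h *ᵥ x + y ⬝ᵥ blockA Λ₀ h *ᵥ y)
          + 1 / 4 * ((x + y) ⬝ᵥ blockCBC Λ₀ h *ᵥ (x + y))) := by
  rw [reducedKernel]
  simp_rw [stateKernel_zero_glue Λ₀ hV hγ hdiag]
  have := (integral_gaussian_quadratic_linear (blockB_posDef Λ₀ hV hγ hdiag) 0
    ((blockC Λ₀ h)ᵀ *ᵥ (x + y)) 1 1).2
  simp only [zero_dotProduct, add_zero, one_mul, mul_zero, sub_zero, mul_one] at this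
  rw [integral_const_mul, this, dotProduct_blockCBC, Real.exp_add]
  ring

/-- The integral over the traced-out variables has mean `-B⁻¹Cᵀ(x+y)/2`, which turns
`⟨v_k, (x,u)⟩` into `⟨a, x-y⟩/2 + ⟨ν_k, x+y⟩/2` with `a = (v_k)_{Λ₀}`. -/
lemma reducedKernel_single (k : Λ) (x y : {i // i ∈ Λ₀} → ℝ) :
    reducedKernel Λ₀ (stateKernel V γ (Pi.single k 1)) x y
      = reducedKernel Λ₀ (stateKernel V γ 0) x y * (2 * γ k)
        * (1 / 4 * (nuVec Λ₀ h V k ⬝ᵥ (x + y)) ^ 2 - 1 / 4 * (eigvecIn Λ₀ V k ⬝ᵥ (x - y)) ^ 2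
          + 1 / 2 * ((rowsOut Λ₀ V)ᵀ * (blockB Λ₀ h)⁻¹ * rowsOut Λ₀ V) k k) := by
  rw [reducedKernel_zero Λ₀ hV hγ hdiag, reducedKernel]
  simp_rw [stateKernel_single_glue Λ₀ hV hγ hdiag]
  have ho : eigvecOut Λ₀ V k ⬝ᵥ (blockB Λ₀ h)⁻¹ *ᵥ eigvecOut Λ₀ V k
      = ((rowsOut Λ₀ V)ᵀ * (blockB Λ₀ h)⁻¹ * rowsOut Λ₀ V) k k := by
    rw [Matrix.dotProduct_mulVec]
    rfl
  have hb : eigvecOut Λ₀ V k ⬝ᵥ (blockB Λ₀ h)⁻¹ *ᵥ ((blockC Λ₀ h)ᵀ *ᵥ (x + y))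
      = eigvecIn Λ₀ V k ⬝ᵥ (x + y) - nuVec Λ₀ h V k ⬝ᵥ (x + y) := by
    rw [nuVec, sub_dotProduct, sub_sub_cancel, ← Matrix.mulVec_mulVec, Matrix.dotProduct_mulVec,
      ← Matrix.mulVec_transpose, blockB_inv_transpose Λ₀ hV hγ hdiag, Matrix.dotProduct_mulVec,
      Matrix.vecMul_transpose]
  rw [integral_const_mul,
    (integral_gaussian_quadratic_linear (blockB_posDef Λ₀ hV hγ hdiag) _ _ _ _).2, ho, hb,
    dotProduct_blockCBC, Real.exp_add, dotProduct_add, dotProduct_add, dotProduct_sub]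
  ring

end

end ReducedKernel

/-! ### Matrix elements after the change of variables -/

section TransformedEntry

variable {ι : Type*} [Fintype ι] [DecidableEq ι]

lemma changeVarAdj_mulVec {F : Matrix ι ι ℝ} (hF : F.det ≠ 0) (φ : (ι → ℝ) → ℝ) (z : ι → ℝ) :
    changeVarAdj F φ (F *ᵥ z) = |F.det| ^ (-(1 / 2) : ℝ) * φ z := by
  rw [changeVarAdj, Matrix.mulVec_mulVec, Matrix.nonsing_inv_mul _ hF.isUnit, Matrix.one_mulVec]

lemma transformedEntry_eq {F : Matrix ι ι ℝ} (hF : F.det ≠ 0) (K : (ι → ℝ) → (ι → ℝ) → ℝ)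
    (φ : (ι → ℝ) → ℝ)
    (hI : Integrable (fun p : (ι → ℝ) × (ι → ℝ) =>
      φ p.1 * K (F *ᵥ p.1) (F *ᵥ p.2) * φ p.2)) :
    transformedEntry F K φ
      = |F.det| * ∫ p : (ι → ℝ) × (ι → ℝ), φ p.1 * K (F *ᵥ p.1) (F *ᵥ p.2) * φ p.2 := by
  have hpos : 0 < |F.det| := abs_pos.2 hF
  have hone : |F.det| ^ (1 / 2 : ℝ) * |F.det| ^ (-(1 / 2) : ℝ) = 1 := by
    rw [← Real.rpow_add hpos]
    norm_num
  rw [Measure.volume_eq_prod] at hI ⊢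
  rw [integral_prod _ hI, transformedEntry, ← integral_const_mul]
  congr 1
  ext x
  rw [changeVar, integralOp, ← integral_comp_mulVec hF]
  simp_rw [changeVarAdj_mulVec hF]
  have : ∀ z, φ x * K (F *ᵥ x) (F *ᵥ z) * φ z
      = |F.det| ^ (1 / 2 : ℝ) * φ x
        * (K (F *ᵥ x) (F *ᵥ z) * (|F.det| ^ (-(1 / 2) : ℝ) * φ z)) := fun z => by
    linear_combination (-(φ x * K (F *ᵥ x) (F *ᵥ z) * φ z)) * hone
  simp_rw [this]
  rw [integral_const_mul]
  ring

lemma integrable_changeVarAdj {F : Matrix ι ι ℝ} (hF : F.det ≠ 0)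
    (K : (ι → ℝ) → (ι → ℝ) → ℝ) (φ : (ι → ℝ) → ℝ)
    (hI : Integrable (fun p : (ι → ℝ) × (ι → ℝ) =>
      φ p.1 * K (F *ᵥ p.1) (F *ᵥ p.2) * φ p.2)) :
    Integrable (fun p : (ι → ℝ) × (ι → ℝ) =>
      φ p.1 * K (F *ᵥ p.1) p.2 * changeVarAdj F φ p.2) := by
  have hemb : MeasurableEmbedding (Prod.map (id : (ι → ℝ) → (ι → ℝ)) (fun z => F *ᵥ z)) :=
    MeasurableEmbedding.id.prodMap (measurableEmbedding_mulVec hF)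
  have hmap : Measure.map (Prod.map (id : (ι → ℝ) → (ι → ℝ)) (fun z => F *ᵥ z)) volume
      = ENNReal.ofReal |F.det⁻¹| • volume := by
    rw [Measure.volume_eq_prod, ← Measure.map_prod_map _ _ measurable_id
      (measurableEmbedding_mulVec hF).measurable, map_mulVec_volume hF, Measure.map_id,
      Measure.prod_smul_right]
  have h := hemb.integrable_map_iff (μ := volume)
    (g := fun p : (ι → ℝ) × (ι → ℝ) => φ p.1 * K (F *ᵥ p.1) p.2 * changeVarAdj F φ p.2)
  rw [hmap, integrable_smul_measure (by simpa using hF) (by simp)] at h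
  rw [h]
  refine (hI.const_mul (|F.det| ^ (-(1 / 2) : ℝ))).congr (Filter.Eventually.of_forall fun p => ?_)
  simp only [Function.comp_apply, Prod.map_fst, Prod.map_snd, id, changeVarAdj_mulVec hF]
  ring

omit [DecidableEq ι] in
lemma integrable_arrow_prod_iff {f : (ι → ℝ) × (ι → ℝ) → ℝ} :
    Integrable (fun z : ι → ℝ × ℝ => f (fun j => (z j).1, fun j => (z j).2)) ↔ Integrable f :=
  (volume_measurePreserving_arrowProdEquivProdArrow ℝ ℝ ι).integrable_comp_emb
    (MeasurableEquiv.measurableEmbedding _)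

omit [DecidableEq ι] in
lemma integral_arrow_prod (f : (ι → ℝ) × (ι → ℝ) → ℝ) :
    ∫ z : ι → ℝ × ℝ, f (fun j => (z j).1, fun j => (z j).2) = ∫ p, f p :=
  (volume_measurePreserving_arrowProdEquivProdArrow ℝ ℝ ι).integral_comp' f

end TransformedEntry

/-! ### Mehler kernels in terms of `μ` -/

section Parameters

variable {ι : Type*} {σ : ι → ℝ}

lemma one_add_eq (hσ : ∀ j, -1 < σ j ∧ σ j ≤ 0) (j : ι) : 1 + σ j = 2 / (1 + mu σ j ^ 2) := by
  have : 1 + σ j ≠ 0 := by linarith [(hσ j).1]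
  rw [mu_sq hσ]
  field_simp
  ring

lemma one_sub_eq (hσ : ∀ j, -1 < σ j ∧ σ j ≤ 0) (j : ι) :
    1 - σ j = 2 * mu σ j ^ 2 / (1 + mu σ j ^ 2) := by
  have : 1 + mu σ j ^ 2 ≠ 0 := by positivity
  have h := one_add_eq hσ j
  field_simp at h ⊢
  linear_combination -h

lemma kappa_pos (hσ : ∀ j, -1 < σ j ∧ σ j ≤ 0) (j : ι) : 0 < kappa σ j := by
  have := zero_lt_one.trans_le (one_le_mu hσ j)
  rw [kappa]
  positivity

lemma kappa_sq_add_sq (hσ : ∀ j, -1 < σ j ∧ σ j ≤ 0) (j : ι) : kappa σ j ^ 2 + σ j ^ 2 = 1 := by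
  have : 1 + mu σ j ^ 2 ≠ 0 := by positivity
  have h : σ j = 2 / (1 + mu σ j ^ 2) - 1 := by rw [← one_add_eq hσ]; ring
  rw [h, kappa]
  field_simp
  ring

lemma abs_sigma_le (hσ : ∀ j, -1 < σ j ∧ σ j ≤ 0) (j : ι) : |σ j| ≤ 1 :=
  abs_le.2 ⟨(hσ j).1.le, (hσ j).2.trans zero_le_one⟩

lemma one_add_kappa_eq (σ : ι → ℝ) (j : ι) :
    1 + kappa σ j = (1 + mu σ j) ^ 2 / (1 + mu σ j ^ 2) := by
  have : 1 + mu σ j ^ 2 ≠ 0 := by positivity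
  rw [kappa]
  field_simp
  ring

/-- The ratio of consecutive eigenvalues of the Mehler kernel, in terms of `μ`. -/
lemma neg_sigma_div_one_add_kappa (hσ : ∀ j, -1 < σ j ∧ σ j ≤ 0) (j : ι) :
    -σ j / (1 + kappa σ j) = (mu σ j - 1) / (mu σ j + 1) := by
  have hm := one_le_mu hσ j
  have h1 : 1 + mu σ j ^ 2 ≠ 0 := by positivity
  have h2 : 1 + mu σ j ≠ 0 := by positivity
  have h2' : mu σ j + 1 ≠ 0 := by positivity
  have h : σ j = 2 / (1 + mu σ j ^ 2) - 1 := by rw [← one_add_eq hσ]; ring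
  rw [one_add_kappa_eq]
  nth_rewrite 1 [h]
  field_simp
  ring

/-- The second moment of `x + y` in a matrix element of the Mehler kernel. -/
lemma moment_add_eq {m : ℝ} (hm : 1 ≤ m) (n : ℕ) :
    2 * m ^ 2 / (1 + m ^ 2) / (2 * (2 * m / (1 + m ^ 2)))
        * ((2 * n + 1) * ((m - 1) / (m + 1)) ^ n
          + 1 * ((n + 1) * ((m - 1) / (m + 1)) ^ (n + 1) + n * ((m - 1) / (m + 1)) ^ (n - 1)))
      = 2 * m ^ 3 / (m + 1) ^ 2 * n * ((m - 1) / (m + 1)) ^ (n - 1)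
        + m ^ 2 / (m + 1) * ((m - 1) / (m + 1)) ^ n := by
  have h1 : 1 + m ^ 2 ≠ 0 := by positivity
  have h2 : m + 1 ≠ 0 := by positivity
  have h3 : m ≠ 0 := by positivity
  have hc : 2 * m ^ 2 / (1 + m ^ 2) / (2 * (2 * m / (1 + m ^ 2))) = m / 2 := by field_simp
  have hr : ∀ r : ℝ, r * (m + 1) = m - 1 → (m - 1) / (m + 1) = r := fun r hr => by
    rw [← hr, mul_div_cancel_right₀ _ h2]
  obtain ⟨r, hrm⟩ : ∃ r : ℝ, r * (m + 1) = m - 1 := ⟨_, div_mul_cancel₀ _ h2⟩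
  rw [hc, hr r hrm]
  have hr1 : r = 1 - 2 / (m + 1) := by field_simp; linear_combination hrm
  cases n with
  | zero =>
    simp only [hr1, Nat.cast_zero, pow_zero, zero_add, pow_one]
    field_simp
    ring
  | succ n =>
    rw [add_tsub_cancel_right, pow_succ r (n + 1), pow_succ r n]
    generalize r ^ n = t
    rw [hr1]
    push_cast
    field_simp
    ring

/-- The second moment of `x - y` in a matrix element of the Mehler kernel. -/
lemma moment_sub_eq {m : ℝ} (hm : 1 ≤ m) (n : ℕ) :
    2 * m ^ 2 / (1 + m ^ 2) / (2 * (2 * m / (1 + m ^ 2)))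
        * ((2 * n + 1) * ((m - 1) / (m + 1)) ^ n
          + -1 * ((n + 1) * ((m - 1) / (m + 1)) ^ (n + 1) + n * ((m - 1) / (m + 1)) ^ (n - 1)))
      = m / (m + 1) * ((m - 1) / (m + 1)) ^ n
        - 2 * m / (m + 1) ^ 2 * n * ((m - 1) / (m + 1)) ^ (n - 1) := by
  have h1 : 1 + m ^ 2 ≠ 0 := by positivity
  have h2 : m + 1 ≠ 0 := by positivity
  have h3 : m ≠ 0 := by positivity
  have hc : 2 * m ^ 2 / (1 + m ^ 2) / (2 * (2 * m / (1 + m ^ 2))) = m / 2 := by field_simp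
  have hr : ∀ r : ℝ, r * (m + 1) = m - 1 → (m - 1) / (m + 1) = r := fun r hr => by
    rw [← hr, mul_div_cancel_right₀ _ h2]
  obtain ⟨r, hrm⟩ : ∃ r : ℝ, r * (m + 1) = m - 1 := ⟨_, div_mul_cancel₀ _ h2⟩
  rw [hc, hr r hrm]
  have hr1 : r = 1 - 2 / (m + 1) := by field_simp; linear_combination hrm
  cases n with
  | zero =>
    simp only [hr1, Nat.cast_zero, pow_zero, zero_add, pow_one]
    field_simp
    ring
  | succ n =>
    rw [add_tsub_cancel_right, pow_succ r (n + 1), pow_succ r n]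
    generalize r ^ n = t
    rw [hr1]
    push_cast
    field_simp
    ring

lemma sqrt_mul_integral_mehlerElement (hσ : ∀ j, -1 < σ j ∧ σ j ≤ 0) (j : ι) (n : ℕ) :
    √((1 + σ j) / Real.pi) * ∫ z, mehlerElement (kappa σ j) (σ j) n z
      = 2 / (1 + mu σ j) * ((mu σ j - 1) / (mu σ j + 1)) ^ n := by
  have hm := one_le_mu hσ j
  have hpi := Real.pi_pos.ne'
  have h1 : 1 + mu σ j ^ 2 ≠ 0 := by positivity
  have h2 : 1 + mu σ j ≠ 0 := by positivity
  have h3 : 0 ≤ (1 + σ j) / Real.pi := div_nonneg (by linarith [(hσ j).1]) Real.pi_pos.le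
  rw [integral_mehlerElement (kappa_pos hσ j) (kappa_sq_add_sq hσ j) (abs_sigma_le hσ j),
    neg_sigma_div_one_add_kappa hσ, ← mul_assoc, ← Real.sqrt_mul h3, one_add_kappa_eq,
    one_add_eq hσ]
  congr 1
  rw [show 2 / (1 + mu σ j ^ 2) / Real.pi
      * (2 * Real.pi / ((1 + mu σ j) ^ 2 / (1 + mu σ j ^ 2))) = (2 / (1 + mu σ j)) ^ 2 by
    field_simp]
  exact Real.sqrt_sq (by positivity)

lemma integrable_sq_sum_mehlerElement [Fintype ι] (hσ : ∀ j, -1 < σ j ∧ σ j ≤ 0) (n : ι → ℕ)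
    (c : ι → ℝ) {ε : ℝ} (hε : ε ^ 2 = 1) :
    Integrable (fun z : ι → ℝ × ℝ => (∑ j, c j * ((z j).1 + ε * (z j).2)) ^ 2
      * ∏ j, mehlerElement (kappa σ j) (σ j) (n j) (z j)) :=
  integrable_sq_sum_mul_prod (G := fun j z => mehlerElement (kappa σ j) (σ j) (n j) z)
    (ℓ := fun _ z => z.1 + ε * z.2)
    (fun j => integrable_mehlerElement (kappa_pos hσ j) (abs_sigma_le hσ j) (n j))
    (fun j => integrable_linear_mul_mehlerElement (kappa_pos hσ j) (abs_sigma_le hσ j) (n j) ε)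
    (fun j => integrable_sq_linear_mul_mehlerElement (kappa_pos hσ j) (abs_sigma_le hσ j) (n j) hε)
    c

lemma integral_sq_sum_mehlerElement [Fintype ι] [DecidableEq ι]
    (hσ : ∀ j, -1 < σ j ∧ σ j ≤ 0) (n : ι → ℕ) (c : ι → ℝ) {ε : ℝ} (hε : ε ^ 2 = 1) :
    ∫ z : ι → ℝ × ℝ, (∑ j, c j * ((z j).1 + ε * (z j).2)) ^ 2
        * ∏ j, mehlerElement (kappa σ j) (σ j) (n j) (z j)
      = ∑ j, c j ^ 2
        * ((∫ z : ℝ × ℝ, (z.1 + ε * z.2) ^ 2 * mehlerElement (kappa σ j) (σ j) (n j) z)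
          * ∏ i ∈ Finset.univ.erase j, ∫ z, mehlerElement (kappa σ i) (σ i) (n i) z) :=
  integral_sq_sum_mul_prod (G := fun j z => mehlerElement (kappa σ j) (σ j) (n j) z)
    (ℓ := fun _ z => z.1 + ε * z.2)
    (fun j => integrable_mehlerElement (kappa_pos hσ j) (abs_sigma_le hσ j) (n j))
    (fun j => integrable_linear_mul_mehlerElement (kappa_pos hσ j) (abs_sigma_le hσ j) (n j) ε)
    (fun j => integrable_sq_linear_mul_mehlerElement (kappa_pos hσ j) (abs_sigma_le hσ j) (n j) hε)
    (fun j => integral_linear_mul_mehlerElement (kappa_pos hσ j) (kappa_sq_add_sq hσ j)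
      (abs_sigma_le hσ j) (n j) ε) c

end Parameters

/-! ### The diagonal entries -/

section Entries

variable {Λ : Type*} [Fintype Λ] [DecidableEq Λ] {Λ₀ : Finset Λ} {h V : Matrix Λ Λ ℝ} {γ : Λ → ℝ}
  {F : Matrix {i // i ∈ Λ₀} {i // i ∈ Λ₀} ℝ} {σ : {i // i ∈ Λ₀} → ℝ}

/-- The prefactor of the product of Mehler kernels in the transformed reduced ground state. -/
def entryConst (Λ₀ : Finset Λ) (h : Matrix Λ Λ ℝ) (γ : Λ → ℝ) : ℝ :=
  groundNorm γ ^ 2 * gaussianMass (blockB Λ₀ h)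

lemma quadratic_mulVec {ι : Type*} [Fintype ι] [DecidableEq ι] {M R : Matrix ι ι ℝ} {d : ι → ℝ}
    (hM : Rᵀ * M * R = diagonal d) (x : ι → ℝ) :
    (R *ᵥ x) ⬝ᵥ M *ᵥ (R *ᵥ x) = ∑ j, d j * x j ^ 2 := by
  have h1 : (R *ᵥ x) ⬝ᵥ M *ᵥ (R *ᵥ x) = x ⬝ᵥ (Rᵀ * M * R) *ᵥ x := by
    rw [← Matrix.mulVec_mulVec, ← Matrix.mulVec_mulVec, Matrix.dotProduct_mulVec x Rᵀ,
      Matrix.vecMul_transpose]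
  rw [h1, hM]
  refine Finset.sum_congr rfl fun j _ => ?_
  rw [Matrix.mulVec_diagonal]
  ring

variable (hV : V ∈ orthogonalGroup Λ ℝ) (hγ : ∀ k, 0 < γ k)
  (hdiag : h = V * diagonal (fun k => γ k ^ 2) * Vᵀ)
  (hσ : ∀ j, -1 < σ j ∧ σ j ≤ 0)
  (hFA : Fᵀ * blockA Λ₀ h * F = diagonal (fun j => 1 - σ j))
  (hFT : Fᵀ * (blockA Λ₀ h - blockCBC Λ₀ h) * F = diagonal (fun j => 1 + σ j))

include hV hγ hdiag hFA hFT

/-- In the new coordinates the reduced ground state is a product of Mehler kernels. -/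
lemma ground_integrand_eq (n : {i // i ∈ Λ₀} → ℕ) (z : {i // i ∈ Λ₀} → ℝ × ℝ) :
    hermiteProd (kappa σ) n (fun j => (z j).1)
        * reducedKernel Λ₀ (stateKernel V γ 0) (F *ᵥ fun j => (z j).1) (F *ᵥ fun j => (z j).2)
        * hermiteProd (kappa σ) n (fun j => (z j).2)
      = entryConst Λ₀ h γ * ∏ j, mehlerElement (kappa σ j) (σ j) (n j) (z j) := by
  have hFK : Fᵀ * blockCBC Λ₀ h * F = diagonal (fun j => -2 * σ j) := by
    have : Fᵀ * blockCBC Λ₀ h * F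
        = Fᵀ * blockA Λ₀ h * F - Fᵀ * (blockA Λ₀ h - blockCBC Λ₀ h) * F := by
      rw [Matrix.mul_sub, Matrix.sub_mul, sub_sub_cancel]
    rw [this, hFA, hFT, diagonal_sub]
    congr 1
    ext j
    ring
  have hprod : ∏ j, mehlerElement (kappa σ j) (σ j) (n j) (z j)
      = hermiteProd (kappa σ) n (fun j => (z j).1)
        * Real.exp (∑ j, (-(1 / 2) * ((z j).1 ^ 2 + (z j).2 ^ 2) - σ j * (z j).1 * (z j).2))
        * hermiteProd (kappa σ) n (fun j => (z j).2) := by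
    rw [Real.exp_sum, hermiteProd, hermiteProd, ← Finset.prod_mul_distrib,
      ← Finset.prod_mul_distrib]
    rfl
  rw [reducedKernel_zero Λ₀ hV hγ hdiag, hprod, ← Matrix.mulVec_add, quadratic_mulVec hFA,
    quadratic_mulVec hFA, quadratic_mulVec hFK, entryConst, ← Finset.sum_add_distrib,
    Finset.mul_sum, Finset.mul_sum, ← Finset.sum_add_distrib]
  have : ∀ j : {i // i ∈ Λ₀}, -(1 / 2) * ((1 - σ j) * (z j).1 ^ 2 + (1 - σ j) * (z j).2 ^ 2)
      + 1 / 4 * (-2 * σ j * (((fun j => (z j).1) + fun j => (z j).2) j) ^ 2)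
      = -(1 / 2) * ((z j).1 ^ 2 + (z j).2 ^ 2) - σ j * (z j).1 * (z j).2 := fun j => by
    simp only [Pi.add_apply]
    ring
  simp_rw [this]
  ring

lemma single_integrand_eq (k : Λ) (n : {i // i ∈ Λ₀} → ℕ) (z : {i // i ∈ Λ₀} → ℝ × ℝ) :
    hermiteProd (kappa σ) n (fun j => (z j).1)
        * reducedKernel Λ₀ (stateKernel V γ (Pi.single k 1)) (F *ᵥ fun j => (z j).1)
          (F *ᵥ fun j => (z j).2)
        * hermiteProd (kappa σ) n (fun j => (z j).2)
      = entryConst Λ₀ h γ * (2 * γ k)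
        * (1 / 4 * ((∑ j, (Fᵀ *ᵥ nuVec Λ₀ h V k) j * ((z j).1 + 1 * (z j).2)) ^ 2
              * ∏ j, mehlerElement (kappa σ j) (σ j) (n j) (z j))
          - 1 / 4 * ((∑ j, (Fᵀ *ᵥ eigvecIn Λ₀ V k) j * ((z j).1 + -1 * (z j).2)) ^ 2
              * ∏ j, mehlerElement (kappa σ j) (σ j) (n j) (z j))
          + 1 / 2 * ((rowsOut Λ₀ V)ᵀ * (blockB Λ₀ h)⁻¹ * rowsOut Λ₀ V) k k
              * ∏ j, mehlerElement (kappa σ j) (σ j) (n j) (z j)) := by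
  have hlin : ∀ a x : {i // i ∈ Λ₀} → ℝ, a ⬝ᵥ F *ᵥ x = ∑ j, (Fᵀ *ᵥ a) j * x j := fun a x => by
    rw [Matrix.dotProduct_mulVec, ← Matrix.mulVec_transpose]; rfl
  have h1 : nuVec Λ₀ h V k ⬝ᵥ ((F *ᵥ fun j => (z j).1) + F *ᵥ fun j => (z j).2)
      = ∑ j, (Fᵀ *ᵥ nuVec Λ₀ h V k) j * ((z j).1 + 1 * (z j).2) := by
    rw [← Matrix.mulVec_add, hlin]
    simp only [Pi.add_apply, one_mul]
  have h2 : eigvecIn Λ₀ V k ⬝ᵥ ((F *ᵥ fun j => (z j).1) - F *ᵥ fun j => (z j).2)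
      = ∑ j, (Fᵀ *ᵥ eigvecIn Λ₀ V k) j * ((z j).1 + -1 * (z j).2) := by
    rw [← Matrix.mulVec_sub, hlin]
    simp only [Pi.sub_apply, neg_one_mul, sub_eq_add_neg]
  have h0 := ground_integrand_eq hV hγ hdiag hFA hFT n z
  rw [reducedKernel_single Λ₀ hV hγ hdiag, h1, h2]
  linear_combination (2 * γ k * (1 / 4 * (∑ j, (Fᵀ *ᵥ nuVec Λ₀ h V k) j
      * ((z j).1 + 1 * (z j).2)) ^ 2 - 1 / 4 * (∑ j, (Fᵀ *ᵥ eigvecIn Λ₀ V k) j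
      * ((z j).1 + -1 * (z j).2)) ^ 2
    + 1 / 2 * ((rowsOut Λ₀ V)ᵀ * (blockB Λ₀ h)⁻¹ * rowsOut Λ₀ V) k k)) * h0

include hσ

omit hFA in
/-- The prefactor follows from `det B det T = ∏ γ_k` and `(det F)² det T = ∏ (1 + σ_j)`, where
`T = A - C B⁻¹ Cᵀ`. -/
lemma det_mul_entryConst (hF : F.det ≠ 0) :
    |F.det| * entryConst Λ₀ h γ = ∏ j, √((1 + σ j) / Real.pi) := by
  obtain ⟨hg, hgB⟩ := gaussianMass_sq_mul_det (blockB_posDef Λ₀ hV hγ hdiag)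
  have hdet := det_blockB_mul_det_schurComplement Λ₀ hV hγ hdiag
  have hFd := congrArg det hFT
  rw [det_mul, det_mul, det_transpose, det_diagonal] at hFd
  rw [schurComplement] at hdet
  have hγ' : ∏ k, γ k ≠ 0 := (Finset.prod_pos fun k _ => hγ k).ne'
  have hBdet : (blockB Λ₀ h).det ≠ 0 := (blockB_isUnit_det Λ₀ hV hγ hdiag).ne_zero
  have hpi := Real.pi_pos.ne'
  have hcard : Real.pi ^ Fintype.card Λ
      = Real.pi ^ Fintype.card {i // i ∈ Λ₀} * Real.pi ^ Fintype.card {i // i ∉ Λ₀} := by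
    rw [← pow_add]
    congr 1
    rw [← Fintype.card_sum]
    convert (Fintype.card_congr (Equiv.sumCompl (fun i => i ∈ Λ₀))).symm
  have hn : (∏ k, √(γ k / Real.pi)) ^ 2 = (∏ k, γ k) / Real.pi ^ Fintype.card Λ := by
    rw [← Finset.prod_pow, ← Finset.card_univ, ← Finset.prod_const, ← Finset.prod_div_distrib]
    exact Finset.prod_congr rfl fun k _ => Real.sq_sqrt (div_pos (hγ k) Real.pi_pos).le
  have hs : (∏ j, √((1 + σ j) / Real.pi)) ^ 2
      = (∏ j, (1 + σ j)) / Real.pi ^ Fintype.card {i // i ∈ Λ₀} := by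
    rw [← Finset.prod_pow, ← Finset.card_univ, ← Finset.prod_const, ← Finset.prod_div_distrib]
    exact Finset.prod_congr rfl fun j _ =>
      Real.sq_sqrt (div_pos (by linarith [(hσ j).1]) Real.pi_pos).le
  refine (pow_left_inj₀ (by rw [entryConst]; positivity)
    (Finset.prod_nonneg fun j _ => Real.sqrt_nonneg _) two_ne_zero).1 ?_
  rw [hs, entryConst, groundNorm_sq hγ, mul_pow, mul_pow, sq_abs, hn, ← hFd, hcard,
    eq_div_iff (pow_ne_zero _ hpi), ← hdet, ← hgB]
  have h2 : gaussianMass (blockB Λ₀ h) ≠ 0 := hg.ne'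
  field_simp

lemma integrable_ground_integrand (n : {i // i ∈ Λ₀} → ℕ) :
    Integrable (fun p : ({i // i ∈ Λ₀} → ℝ) × ({i // i ∈ Λ₀} → ℝ) =>
      hermiteProd (kappa σ) n p.1
        * reducedKernel Λ₀ (stateKernel V γ 0) (F *ᵥ p.1) (F *ᵥ p.2)
        * hermiteProd (kappa σ) n p.2) := by
  rw [← integrable_arrow_prod_iff]
  simp_rw [ground_integrand_eq hV hγ hdiag hFA hFT]
  exact (Integrable.fintype_prod (μ := fun _ : {i // i ∈ Λ₀} => (volume : Measure (ℝ × ℝ)))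
    fun j => integrable_mehlerElement (kappa_pos hσ j) (abs_sigma_le hσ j) (n j)).const_mul _

lemma integrable_single_integrand (k : Λ) (n : {i // i ∈ Λ₀} → ℕ) :
    Integrable (fun p : ({i // i ∈ Λ₀} → ℝ) × ({i // i ∈ Λ₀} → ℝ) =>
      hermiteProd (kappa σ) n p.1
        * reducedKernel Λ₀ (stateKernel V γ (Pi.single k 1)) (F *ᵥ p.1) (F *ᵥ p.2)
        * hermiteProd (kappa σ) n p.2) := by
  rw [← integrable_arrow_prod_iff]
  simp_rw [single_integrand_eq hV hγ hdiag hFA hFT]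
  refine Integrable.const_mul ((Integrable.sub ?_ ?_).add ?_) _
  · exact (integrable_sq_sum_mehlerElement hσ n _ (by norm_num)).const_mul _
  · exact (integrable_sq_sum_mehlerElement hσ n _ (by norm_num)).const_mul _
  · exact (Integrable.fintype_prod (μ := fun _ : {i // i ∈ Λ₀} => (volume : Measure (ℝ × ℝ)))
      fun j => integrable_mehlerElement (kappa_pos hσ j) (abs_sigma_le hσ j) (n j)).const_mul _

/-- Each mode contributes an eigenvalue of its Mehler kernel, scaled by `((1+σ_j)/π)^{1/2}`. -/
lemma transformedEntry_ground (hF : F.det ≠ 0) (n : {i // i ∈ Λ₀} → ℕ) :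
    transformedEntry F (reducedKernel Λ₀ (stateKernel V γ 0)) (hermiteProd (kappa σ) n)
      = ∏ j, (2 / (1 + mu σ j) * ((mu σ j - 1) / (mu σ j + 1)) ^ n j) := by
  rw [transformedEntry_eq hF _ _ (integrable_ground_integrand hV hγ hdiag hσ hFA hFT n),
    ← integral_arrow_prod]
  simp_rw [ground_integrand_eq hV hγ hdiag hFA hFT]
  rw [integral_const_mul, integral_fintype_prod_volume_eq_prod
    (fun j z => mehlerElement (kappa σ j) (σ j) (n j) z), ← mul_assoc,
    det_mul_entryConst hV hγ hdiag hσ hFT hF, ← Finset.prod_mul_distrib]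
  exact Finset.prod_congr rfl fun j _ => sqrt_mul_integral_mehlerElement hσ j (n j)

/-- The ground state entry with the occupation number of `j` replaced by `m`; only the factor of `j`
changes. -/
lemma entryConst_mul_prod_erase (hF : F.det ≠ 0) (n : {i // i ∈ Λ₀} → ℕ) (j : {i // i ∈ Λ₀})
    (m : ℕ) :
    |F.det| * entryConst Λ₀ h γ * (√(2 * Real.pi / (1 + kappa σ j))
        * ((mu σ j - 1) / (mu σ j + 1)) ^ m
        * ∏ i ∈ Finset.univ.erase j, ∫ z, mehlerElement (kappa σ i) (σ i) (n i) z)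
      = transformedEntry F (reducedKernel Λ₀ (stateKernel V γ 0))
        (hermiteProd (kappa σ) (Function.update n j m)) := by
  rw [transformedEntry_ground hV hγ hdiag hσ hFA hFT hF,
    det_mul_entryConst hV hγ hdiag hσ hFT hF, ← neg_sigma_div_one_add_kappa hσ,
    ← integral_mehlerElement (kappa_pos hσ j) (kappa_sq_add_sq hσ j) (abs_sigma_le hσ j),
    ← Finset.mul_prod_erase _ _ (Finset.mem_univ j),
    ← Finset.mul_prod_erase Finset.univ (fun i => 2 / (1 + mu σ i) * _) (Finset.mem_univ j),
    Function.update_self, ← sqrt_mul_integral_mehlerElement hσ, mul_mul_mul_comm,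
    ← Finset.prod_mul_distrib]
  congr 1
  refine Finset.prod_congr rfl fun i hi => ?_
  rw [sqrt_mul_integral_mehlerElement hσ, Function.update_of_ne (Finset.ne_of_mem_erase hi)]

lemma transformedEntry_single_aux (hF : F.det ≠ 0) (k : Λ) (n : {i // i ∈ Λ₀} → ℕ) :
    transformedEntry F (reducedKernel Λ₀ (stateKernel V γ (Pi.single k 1)))
        (hermiteProd (kappa σ) n)
      = |F.det| * entryConst Λ₀ h γ * (2 * γ k)
        * (1 / 4 * ∑ j, (Fᵀ *ᵥ nuVec Λ₀ h V k) j ^ 2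
              * ((∫ z : ℝ × ℝ, (z.1 + 1 * z.2) ^ 2 * mehlerElement (kappa σ j) (σ j) (n j) z)
                * ∏ i ∈ Finset.univ.erase j, ∫ z, mehlerElement (kappa σ i) (σ i) (n i) z)
          - 1 / 4 * ∑ j, (Fᵀ *ᵥ eigvecIn Λ₀ V k) j ^ 2
              * ((∫ z : ℝ × ℝ, (z.1 + -1 * z.2) ^ 2 * mehlerElement (kappa σ j) (σ j) (n j) z)
                * ∏ i ∈ Finset.univ.erase j, ∫ z, mehlerElement (kappa σ i) (σ i) (n i) z)
          + 1 / 2 * ((rowsOut Λ₀ V)ᵀ * (blockB Λ₀ h)⁻¹ * rowsOut Λ₀ V) k k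
              * ∏ j, ∫ z, mehlerElement (kappa σ j) (σ j) (n j) z) := by
  have i0 : Integrable fun z : {i // i ∈ Λ₀} → ℝ × ℝ =>
      ∏ j, mehlerElement (kappa σ j) (σ j) (n j) (z j) :=
    Integrable.fintype_prod (μ := fun _ : {i // i ∈ Λ₀} => (volume : Measure (ℝ × ℝ)))
      fun j => integrable_mehlerElement (kappa_pos hσ j) (abs_sigma_le hσ j) (n j)
  have i1 := (integrable_sq_sum_mehlerElement hσ n (Fᵀ *ᵥ nuVec Λ₀ h V k) (ε := 1)
    (by norm_num)).const_mul (1 / 4)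
  have i2 := (integrable_sq_sum_mehlerElement hσ n (Fᵀ *ᵥ eigvecIn Λ₀ V k) (ε := -1)
    (by norm_num)).const_mul (1 / 4)
  rw [transformedEntry_eq hF _ _ (integrable_single_integrand hV hγ hdiag hσ hFA hFT k n),
    ← integral_arrow_prod]
  simp_rw [single_integrand_eq hV hγ hdiag hFA hFT]
  rw [integral_const_mul, integral_add (by exact i1.sub i2) (i0.const_mul _), integral_sub i1 i2,
    integral_const_mul, integral_const_mul, integral_const_mul, integral_sq_sum_mehlerElement hσ n _ (by norm_num),
    integral_sq_sum_mehlerElement hσ n _ (by norm_num), integral_fintype_prod_volume_eq_prod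
      (fun j z => mehlerElement (kappa σ j) (σ j) (n j) z)]
  ring

/-- The second moments of `x ± y` in the mode `j`, in terms of the ground state entries at `n` and at
`n - δ_j`. -/
lemma entryConst_mul_second_moment (hF : F.det ≠ 0) (n : {i // i ∈ Λ₀} → ℕ)
    (j : {i // i ∈ Λ₀}) :
    (1 - σ j) / 2 * (|F.det| * entryConst Λ₀ h γ)
        * ((∫ z : ℝ × ℝ, (z.1 + 1 * z.2) ^ 2 * mehlerElement (kappa σ j) (σ j) (n j) z)
          * ∏ i ∈ Finset.univ.erase j, ∫ z, mehlerElement (kappa σ i) (σ i) (n i) z)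
      = 2 * mu σ j ^ 3 / (mu σ j + 1) ^ 2 * n j
          * transformedEntry F (reducedKernel Λ₀ (stateKernel V γ 0))
            (hermiteProd (kappa σ) (n - Pi.single j 1))
        + mu σ j ^ 2 / (mu σ j + 1) * transformedEntry F (reducedKernel Λ₀ (stateKernel V γ 0))
            (hermiteProd (kappa σ) n) ∧
    (1 - σ j) / 2 * (|F.det| * entryConst Λ₀ h γ)
        * ((∫ z : ℝ × ℝ, (z.1 + -1 * z.2) ^ 2 * mehlerElement (kappa σ j) (σ j) (n j) z)
          * ∏ i ∈ Finset.univ.erase j, ∫ z, mehlerElement (kappa σ i) (σ i) (n i) z)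
      = mu σ j / (mu σ j + 1) * transformedEntry F (reducedKernel Λ₀ (stateKernel V γ 0))
            (hermiteProd (kappa σ) n)
        - 2 * mu σ j / (mu σ j + 1) ^ 2 * n j
          * transformedEntry F (reducedKernel Λ₀ (stateKernel V γ 0))
            (hermiteProd (kappa σ) (n - Pi.single j 1)) := by
  have hu : n - Pi.single j 1 = Function.update n j (n j - 1) := by
    ext i
    by_cases hi : i = j
    · subst hi; simp
    · simp [hi]
  have e0 := entryConst_mul_prod_erase hV hγ hdiag hσ hFA hFT hF n j (n j)
  have e1 := entryConst_mul_prod_erase hV hγ hdiag hσ hFA hFT hF n j (n j - 1)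
  rw [Function.update_eq_self] at e0
  have hm := one_le_mu hσ j
  have ha := moment_add_eq hm (n j)
  have hs := moment_sub_eq hm (n j)
  rw [← one_sub_eq hσ, ← kappa] at ha hs
  have hκ := (kappa_pos hσ j).ne'
  rw [hu, ← e0, ← e1,
    integral_sq_linear_mul_mehlerElement (kappa_pos hσ j) (kappa_sq_add_sq hσ j)
      (abs_sigma_le hσ j) _ (by norm_num),
    integral_sq_linear_mul_mehlerElement (kappa_pos hσ j) (kappa_sq_add_sq hσ j)
      (abs_sigma_le hσ j) _ (by norm_num), neg_sigma_div_one_add_kappa hσ]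
  set P := ∏ i ∈ Finset.univ.erase j, ∫ z, mehlerElement (kappa σ i) (σ i) (n i) z
  set c := |F.det| * entryConst Λ₀ h γ
  set l := √(2 * Real.pi / (1 + kappa σ j))
  constructor
  · rw [div_mul_eq_div_div] at ha
    linear_combination (c * l * P) * ha
  · rw [div_mul_eq_div_div] at hs
    linear_combination (c * l * P) * hs

end Entries

section SingleExcitation

variable {Λ : Type*} [Fintype Λ] [DecidableEq Λ] {Λ₀ : Finset Λ} {h V : Matrix Λ Λ ℝ} {γ : Λ → ℝ}
  {F F₂ : Matrix {i // i ∈ Λ₀} {i // i ∈ Λ₀} ℝ} {σ : {i // i ∈ Λ₀} → ℝ}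

/-- The coordinates of `Fᵀ v` differ from those of `G v` by the factors `(1 - σ_j)^{1/2}`. -/
lemma sq_transpose_mulVec {ι : Type*} [Fintype ι] [DecidableEq ι] {F G : Matrix ι ι ℝ}
    {σ : ι → ℝ} (hσ : ∀ j, -1 < σ j ∧ σ j ≤ 0)
    (hF : F = Gᵀ * diagonal (fun j => √(1 - σ j))) (v : ι → ℝ) (j : ι) :
    (Fᵀ *ᵥ v) j ^ 2 = (1 - σ j) * (G *ᵥ v) j ^ 2 := by
  rw [hF, Matrix.transpose_mul, Matrix.transpose_transpose, diagonal_transpose,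
    ← Matrix.mulVec_mulVec, Matrix.mulVec_diagonal, mul_pow,
    Real.sq_sqrt (by linarith [(hσ j).2])]

/-- The entry of an excited state. The constant term is rewritten with
`γ_k (∑_j μ_j² ⟨δ_j, G ν_k⟩² + ⟨(v_k)_{Λ∖Λ₀}, B⁻¹ (v_k)_{Λ∖Λ₀}⟩) = 1`, where `G = F₂ᵀ A^{-1/2}`. -/
lemma transformedEntry_single (hV : V ∈ orthogonalGroup Λ ℝ) (hγ : ∀ k, 0 < γ k)
    (hdiag : h = V * diagonal (fun k => γ k ^ 2) * Vᵀ) (hσ : ∀ j, -1 < σ j ∧ σ j ≤ 0)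
    (hF : F = (F₂ᵀ * matPow (blockA Λ₀ h) (-(1 / 2)))ᵀ * diagonal (fun j => √(1 - σ j)))
    (hGA : F₂ᵀ * matPow (blockA Λ₀ h) (-(1 / 2)) * blockA Λ₀ h
      * (F₂ᵀ * matPow (blockA Λ₀ h) (-(1 / 2)))ᵀ = 1)
    (hGT : F₂ᵀ * matPow (blockA Λ₀ h) (-(1 / 2)) * (blockA Λ₀ h - blockCBC Λ₀ h)
      * (F₂ᵀ * matPow (blockA Λ₀ h) (-(1 / 2)))ᵀ = diagonal (fun j => (mu σ j ^ 2)⁻¹))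
    (hdet : F.det ≠ 0) (k : Λ) (n : {i // i ∈ Λ₀} → ℕ) :
    transformedEntry F (reducedKernel Λ₀ (stateKernel V γ (Pi.single k 1)))
        (hermiteProd (kappa σ) n)
      = transformedEntry F (reducedKernel Λ₀ (stateKernel V γ 0)) (hermiteProd (kappa σ) n)
          * (1 - ∑ j, mu σ j / (mu σ j + 1) * weightQ Λ₀ h V γ F₂ σ k j)
        + ∑ j, 2 * mu σ j / (mu σ j + 1) ^ 2 * weightQ Λ₀ h V γ F₂ σ k j * (n j : ℝ)
          * transformedEntry F (reducedKernel Λ₀ (stateKernel V γ 0))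
            (hermiteProd (kappa σ) (n - Pi.single j 1)) := by
  have hFA := form_diagonal hσ hF hGA
  have hFT := form_schur_diagonal hσ hF hGT
  have hone := sum_mu_sq_nuMatrix_add Λ₀ hV hγ hdiag (one_le_mu hσ) hGT k
  have hterm := entryConst_mul_second_moment hV hγ hdiag hσ hFA hFT hdet n
  set G := F₂ᵀ * matPow (blockA Λ₀ h) (-(1 / 2)) with hG
  have hν : ∀ j, (Fᵀ *ᵥ nuVec Λ₀ h V k) j ^ 2 = (1 - σ j) * (G * nuMatrix Λ₀ h V) j k ^ 2 :=
    fun j => sq_transpose_mulVec hσ hF _ j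
  have ha : ∀ j, (Fᵀ *ᵥ eigvecIn Λ₀ V k) j ^ 2 = (1 - σ j) * (G * rowsIn Λ₀ V) j k ^ 2 :=
    fun j => sq_transpose_mulVec hσ hF _ j
  have hmain := transformedEntry_single_aux hV hγ hdiag hσ hFA hFT hdet k n
  have hprod : |F.det| * entryConst Λ₀ h γ * ∏ j, ∫ z, mehlerElement (kappa σ j) (σ j) (n j) z
      = transformedEntry F (reducedKernel Λ₀ (stateKernel V γ 0)) (hermiteProd (kappa σ) n) := by
    rw [transformedEntry_ground hV hγ hdiag hσ hFA hFT hdet,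
      det_mul_entryConst hV hγ hdiag hσ hFT hdet, ← Finset.prod_mul_distrib]
    exact Finset.prod_congr rfl fun j _ => sqrt_mul_integral_mehlerElement hσ j (n j)
  set E := transformedEntry F (reducedKernel Λ₀ (stateKernel V γ 0)) (hermiteProd (kappa σ) n)
  set o := ((rowsOut Λ₀ V)ᵀ * (blockB Λ₀ h)⁻¹ * rowsOut Λ₀ V) k k
  have hsum : transformedEntry F (reducedKernel Λ₀ (stateKernel V γ (Pi.single k 1)))
        (hermiteProd (kappa σ) n)
      = γ k * o * E + ∑ j, (γ k * (mu σ j ^ 2 * (G * nuMatrix Λ₀ h V) j k ^ 2) * E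
        - E * (mu σ j / (mu σ j + 1) * weightQ Λ₀ h V γ F₂ σ k j)
        + 2 * mu σ j / (mu σ j + 1) ^ 2 * weightQ Λ₀ h V γ F₂ σ k j * (n j : ℝ)
          * transformedEntry F (reducedKernel Λ₀ (stateKernel V γ 0))
            (hermiteProd (kappa σ) (n - Pi.single j 1))) := by
    rw [hmain, ← hprod, mul_add, mul_sub, add_comm]
    congr 1
    · ring
    · rw [hprod, Finset.mul_sum, Finset.mul_sum, Finset.mul_sum, Finset.mul_sum,
        ← Finset.sum_sub_distrib]
      refine Finset.sum_congr rfl fun j _ => ?_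
      obtain ⟨h1, h2⟩ := hterm j
      have hm := one_le_mu hσ j
      have hm1 : mu σ j + 1 ≠ 0 := by positivity
      rw [weightQ_eq, ← hG, hν, ha]
      have hsplit : γ k * (mu σ j ^ 2 * (G * nuMatrix Λ₀ h V) j k ^ 2) * E
          = γ k * (G * nuMatrix Λ₀ h V) j k ^ 2 * E
            * (mu σ j ^ 2 / (mu σ j + 1) + mu σ j ^ 3 / (mu σ j + 1)) := by
        field_simp
        ring
      rw [hsplit]
      linear_combination (γ k * (G * nuMatrix Λ₀ h V) j k ^ 2) * h1
        - (γ k * (G * rowsIn Λ₀ V) j k ^ 2) * h2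
  rw [hsum, Finset.sum_add_distrib, Finset.sum_sub_distrib, ← Finset.sum_mul, ← Finset.mul_sum,
    ← Finset.mul_sum]
  linear_combination E * hone

end SingleExcitation

end CoupledOscillators

end

theorem lemma4p4 {Λ : Type*} [Fintype Λ] [DecidableEq Λ] (Λ₀ : Finset Λ)
    -- `h = V diag(γ²) Vᵀ` is positive definite, `V` orthogonal, `γ_k > 0`
    (h V : Matrix Λ Λ ℝ) (γ : Λ → ℝ) (_hh : h.PosDef)
    (_hV : V ∈ Matrix.orthogonalGroup Λ ℝ) (_hγ : ∀ k, 0 < γ k)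
    (_hdiag : h = V * Matrix.diagonal (fun k => γ k ^ 2) * Vᵀ)
    -- `F₂` is orthogonal and `-(1/2) F₁ᵀ C B⁻¹ Cᵀ F₁ = F₂ diag(σ) F₂ᵀ`
    (F₂ : Matrix {i // i ∈ Λ₀} {i // i ∈ Λ₀} ℝ) (σ : {i // i ∈ Λ₀} → ℝ)
    (_hF₂ : F₂ ∈ Matrix.orthogonalGroup {i // i ∈ Λ₀} ℝ)
    (_hσ : (-(1 / 2) : ℝ) • ((CoupledOscillators.matF1 Λ₀ h)ᵀ * CoupledOscillators.blockCBC Λ₀ h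
        * CoupledOscillators.matF1 Λ₀ h) = F₂ * Matrix.diagonal σ * F₂ᵀ) :
    -- the `μ_j` are the eigenvalues of `(1 - Θ)^{-1/2}`, with eigenvectors the columns of `F₂`
    (∀ j, -1 < σ j ∧ σ j ≤ 0 ∧ 1 ≤ CoupledOscillators.mu σ j) ∧
    CoupledOscillators.matPow (1 - CoupledOscillators.matTheta Λ₀ h) (-(1 / 2))
      = F₂ * Matrix.diagonal (CoupledOscillators.mu σ) * F₂ᵀ ∧
    -- the change of variables is invertible, and the integrals that define the reduced kernels
    -- and the diagonal entries converge absolutely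
    IsUnit (CoupledOscillators.matF1 Λ₀ h * F₂).det ∧
    (∀ α : Λ → ℕ, (α = 0 ∨ ∃ k, α = Pi.single k 1) →
      (∀ x y : {i // i ∈ Λ₀} → ℝ, Integrable (fun u : {i // i ∉ Λ₀} → ℝ =>
        CoupledOscillators.stateKernel V γ α
          (CoupledOscillators.glue Λ₀ x u) (CoupledOscillators.glue Λ₀ y u))) ∧
      (∀ n : {i // i ∈ Λ₀} → ℕ, Integrable
        (fun p : ({i // i ∈ Λ₀} → ℝ) × ({i // i ∈ Λ₀} → ℝ) =>
          CoupledOscillators.hermiteProd (CoupledOscillators.kappa σ) n p.1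
          * CoupledOscillators.reducedKernel Λ₀ (CoupledOscillators.stateKernel V γ α)
              ((CoupledOscillators.matF1 Λ₀ h * F₂) *ᵥ p.1) p.2
          * CoupledOscillators.changeVarAdj (CoupledOscillators.matF1 Λ₀ h * F₂)
              (CoupledOscillators.hermiteProd (CoupledOscillators.kappa σ) n) p.2))) ∧
    -- the diagonal entries of the ground state
    (∀ n : {i // i ∈ Λ₀} → ℕ, CoupledOscillators.diagEntry Λ₀ h V γ F₂ σ 0 n
      = ∏ j, (2 / (1 + CoupledOscillators.mu σ j)
          * ((CoupledOscillators.mu σ j - 1) / (CoupledOscillators.mu σ j + 1)) ^ n j)) ∧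
    -- the diagonal entries of the single-excitation states; no division by zero occurs
    (∀ (k : Λ) (n : {i // i ∈ Λ₀} → ℕ), (∀ j, n j ≠ 0 → 1 < CoupledOscillators.mu σ j) →
      CoupledOscillators.diagEntry Λ₀ h V γ F₂ σ (Pi.single k 1) n
        = CoupledOscillators.diagEntry Λ₀ h V γ F₂ σ 0 n
          * (1 - ∑ j, CoupledOscillators.mu σ j / (CoupledOscillators.mu σ j + 1)
                * CoupledOscillators.weightQ Λ₀ h V γ F₂ σ k j
            + ∑ j, 2 * CoupledOscillators.mu σ j / (CoupledOscillators.mu σ j ^ 2 - 1)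
                * CoupledOscillators.weightQ Λ₀ h V γ F₂ σ k j * (n j : ℝ))) ∧
    -- the same formula, multiplied out, without any restriction on `n` and the `μ_j`
    (∀ (k : Λ) (n : {i // i ∈ Λ₀} → ℕ),
      CoupledOscillators.diagEntry Λ₀ h V γ F₂ σ (Pi.single k 1) n
        = CoupledOscillators.diagEntry Λ₀ h V γ F₂ σ 0 n
            * (1 - ∑ j, CoupledOscillators.mu σ j / (CoupledOscillators.mu σ j + 1)
                * CoupledOscillators.weightQ Λ₀ h V γ F₂ σ k j)
          + ∑ j, 2 * CoupledOscillators.mu σ j / (CoupledOscillators.mu σ j + 1) ^ 2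
              * CoupledOscillators.weightQ Λ₀ h V γ F₂ σ k j * (n j : ℝ)
              * CoupledOscillators.diagEntry Λ₀ h V γ F₂ σ 0 (n - Pi.single j 1)) ∧
    -- the bounds on the weights
    (∀ k : Λ, ∑ j, CoupledOscillators.weightQ Λ₀ h V γ F₂ σ k j ≤ 2) ∧
    (∀ j, ∑ k : Λ, CoupledOscillators.weightQ Λ₀ h V γ F₂ σ k j = 2) := by
  have hApos := CoupledOscillators.blockA_posDef Λ₀ _hV _hγ _hdiag
  have hBpos := CoupledOscillators.blockB_posDef Λ₀ _hV _hγ _hdiag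
  have hTpos := CoupledOscillators.schurComplement_posDef Λ₀ _hV _hγ _hdiag
  have hKpos : (CoupledOscillators.blockCBC Λ₀ h).PosSemidef := by
    have := hBpos.inv.posSemidef.mul_mul_conjTranspose_same (CoupledOscillators.blockC Λ₀ h)
    rwa [Matrix.conjTranspose_eq_transpose_of_trivial] at this
  obtain ⟨hσ, hpow, hF, hGA, hGT⟩ := CoupledOscillators.simultaneous_diagonalization hApos hKpos
    hTpos _hF₂ rfl rfl rfl _hσ
  change CoupledOscillators.matPow (1 - CoupledOscillators.matTheta Λ₀ h) (-(1 / 2)) = _ at hpow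
  change CoupledOscillators.matF1 Λ₀ h * F₂ = _ at hF
  have hFA := CoupledOscillators.form_diagonal hσ hF hGA
  have hFT := CoupledOscillators.form_schur_diagonal hσ hF hGT
  have hμ := CoupledOscillators.one_le_mu hσ
  have hdet : (CoupledOscillators.matF1 Λ₀ h * F₂).det ≠ 0 := by
    intro h0
    have := congrArg Matrix.det hFA
    rw [Matrix.det_mul, h0, mul_zero, Matrix.det_diagonal] at this
    exact (Finset.prod_ne_zero_iff.2 fun j _ => by linarith [(hσ j).2]) this.symm
  have hground : ∀ n, CoupledOscillators.diagEntry Λ₀ h V γ F₂ σ 0 n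
      = ∏ j, (2 / (1 + CoupledOscillators.mu σ j)
          * ((CoupledOscillators.mu σ j - 1) / (CoupledOscillators.mu σ j + 1)) ^ n j) :=
    CoupledOscillators.transformedEntry_ground _hV _hγ _hdiag hσ hFA hFT hdet
  have hsingle := CoupledOscillators.transformedEntry_single _hV _hγ _hdiag hσ hF hGA hGT hdet
  refine ⟨fun j => ⟨(hσ j).1, (hσ j).2, hμ j⟩, hpow, hdet.isUnit, ?_, hground, ?_, hsingle, ?_, ?_⟩
  · rintro α (rfl | ⟨k, rfl⟩)
    · exact ⟨CoupledOscillators.integrable_stateKernel_zero Λ₀ _hV _hγ _hdiag, fun n =>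
        CoupledOscillators.integrable_changeVarAdj hdet _ _
          (CoupledOscillators.integrable_ground_integrand _hV _hγ _hdiag hσ hFA hFT n)⟩
    · exact ⟨CoupledOscillators.integrable_stateKernel_single Λ₀ _hV _hγ _hdiag k, fun n =>
        CoupledOscillators.integrable_changeVarAdj hdet _ _
          (CoupledOscillators.integrable_single_integrand _hV _hγ _hdiag hσ hFA hFT k n)⟩
  · intro k n hn
    refine (hsingle k n).trans ?_
    change CoupledOscillators.diagEntry Λ₀ h V γ F₂ σ 0 n * _ + ∑ j, _
        * CoupledOscillators.diagEntry Λ₀ h V γ F₂ σ 0 (n - Pi.single j 1) = _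
    rw [mul_add, Finset.mul_sum]
    congr 1
    refine Finset.sum_congr rfl fun j _ => ?_
    by_cases hnj : n j = 0
    · simp [hnj]
    -- lowering `n_j` by one divides the ground state entry by `(μ_j - 1) / (μ_j + 1)`, which is
    -- nonzero here
    have hm := hn j hnj
    have hlower : CoupledOscillators.diagEntry Λ₀ h V γ F₂ σ 0 n
        = (CoupledOscillators.mu σ j - 1) / (CoupledOscillators.mu σ j + 1)
          * CoupledOscillators.diagEntry Λ₀ h V γ F₂ σ 0 (n - Pi.single j 1) := by
      rw [hground, hground, ← Finset.mul_prod_erase _ _ (Finset.mem_univ j),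
        ← Finset.mul_prod_erase Finset.univ (fun i => 2 / (1 + CoupledOscillators.mu σ i) * _)
          (Finset.mem_univ j)]
      have hrest : ∀ i ∈ Finset.univ.erase j, (n - Pi.single j 1 : {i // i ∈ Λ₀} → ℕ) i = n i := fun i hi => by
        simp [Pi.single_eq_of_ne (Finset.ne_of_mem_erase hi)]
      rw [Finset.prod_congr (g := fun i => 2 / (1 + CoupledOscillators.mu σ i)
        * ((CoupledOscillators.mu σ i - 1) / (CoupledOscillators.mu σ i + 1))
          ^ (n - Pi.single j 1 : {i // i ∈ Λ₀} → ℕ) i) rfl fun i hi => by rw [hrest i hi]]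
      obtain ⟨m, hm'⟩ := Nat.exists_eq_succ_of_ne_zero hnj
      have hj : (n - Pi.single j 1 : {i // i ∈ Λ₀} → ℕ) j = m := by simp [hm']
      rw [hj, hm', Nat.succ_eq_add_one, pow_succ]
      ring
    rw [hlower]
    have h1 : CoupledOscillators.mu σ j + 1 ≠ 0 := by linarith
    have h2 : CoupledOscillators.mu σ j - 1 ≠ 0 := by linarith
    rw [show CoupledOscillators.mu σ j ^ 2 - 1
      = (CoupledOscillators.mu σ j - 1) * (CoupledOscillators.mu σ j + 1) by ring]
    field_simp
  · intro k
    have hone := CoupledOscillators.sum_mu_sq_nuMatrix_add Λ₀ _hV _hγ _hdiag hμ hGT k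
    have hout := CoupledOscillators.rowsOut_blockB_inv_nonneg Λ₀ _hV _hγ _hdiag k
    have hin := CoupledOscillators.sum_rowsIn_le Λ₀ _hV _hγ _hdiag hGA k
    simp_rw [CoupledOscillators.weightQ_eq]
    rw [← Finset.mul_sum, Finset.sum_add_distrib]
    nlinarith [mul_nonneg (_hγ k).le hout]
  · intro j
    have hin := CoupledOscillators.sum_gamma_rowsIn Λ₀ _hV _hγ _hdiag hGA j
    have hν := CoupledOscillators.sum_gamma_nuMatrix Λ₀ _hV _hγ _hdiag hGT j
    have hmu : CoupledOscillators.mu σ j ^ 2 ≠ 0 := pow_ne_zero 2 (by linarith [hμ j])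
    simp_rw [CoupledOscillators.weightQ_eq, mul_add, mul_left_comm (γ _)
      (CoupledOscillators.mu σ j ^ 2)]
    rw [Finset.sum_add_distrib, ← Finset.mul_sum, hin, hν, mul_inv_cancel₀ hmu]
    norm_num
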